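/- **Order-unit spaces.** An order-unit space is a nonzero real partially ordered vector space $A$ with a distinguished element $e \ge 0$ such that every $a\in A$ satisfies $a \le re$ for some $r\in\mathbb R$, and such that $a\le re$ for all $r>0$ implies $a\le 0$. Its norm is $\|a\|=\inf\{r: -re\le a\le re\}$. Its state space $S(A)$ is the set of bounded linear functionals $\mu$ on $A$ with $\mu(e)=1=\|\mu\|$, with the weak-$*$ topology. **Compact quantum metric spaces.** For a seminorm $L$ on $A$ put $\rho_L(\mu,\nu)=\sup\{|\mu(a)-\nu(a)|: L(a)\le 1\}\in[0,\infty]$ for $\mu,\nu\in S(A)$. A Lip-norm on $A$ is a seminorm $L$ such that $L(a)=0$ if and only if $a\in\mathbb R e$, and such that the topology on $S(A)$ given by $\rho_L$ is the weak-$*$ topology. A compact quantum metric space is a pair $(A,L)$ of an order-unit space $A$ and a Lip-norm $L$ on $A$. **Distance.** Let $(A,L_A)$ and $(B,L_B)$ be compact quantum metric spaces. Give $A\oplus B$ the componentwise order and the order unit $(e_A,e_B)$. Let $\mathcal M(L_A,L_B)$ be the set of Lip-norms $L$ on $A\oplus B$ whose quotient seminorms on $A$ and $B$ are $L_A$ and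 $L_B$, that is, $L_A(a)=\inf_{b\in B}L(a,b)$ for all $a\in A$ and $L_B(b)=\inf_{a\in A}L(a,b)$ for all $b\in B$. View $S(A)$ and $S(B)$ as subsets of $S(A\oplus B)$ through the two coordinate projections. The quantum Gromov–Hausdorff distance is $$\mathrm{dist}_q(A,B)=\inf\{\mathrm{dist}_H^{\rho_L}(S(A),S(B)): L\in\mathcal M(L_A,L_B)\},$$ where $\mathrm{dist}_H^{\rho_L}$ is the Hausdorff distance for $\rho_L$. **Isometry.** For a compact quantum metric space $(A,L)$ let $\bar A$ be the norm completion of $A$, with positive cone the closure of that of $A$. Let $K$ be the closure in $\bar A$ of $\{a\in A: L(a)\le 1\}$, let $A^c=\bigcup_{r>0}rK$, and let $L^c$ be the Minkowski functional of $K$ on $A^c$. An isometry from $(A,L_A)$ to $(B,L_B)$ is an order-unit isomorphism $\varphi$ of $A^c$ onto $B^c$ (a linear bijection with $\varphi(e_A)=e_B$ that preserves the order in both directions) such that $L_A^c=L_B^c\circ\varphi$. Being isometric is an equivalence relation on compact quantum metric spaces. **Theorem.** $\mathrm{dist}_q$ is finite and depends only on the isometry classes of its two arguments; it is a metric on the set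 of isometry classes of compact quantum metric spaces; and this metric space is complete. -/

import Mathlib

open scoped ENNReal

universe u

/-- An order-unit space: a real partially ordered vector space with a distinguished order unit
`e > 0` such that every element is dominated by a multiple of `e`, and which is Archimedean.
(Positivity of `e` is part of the usual notion, and `e ≠ 0` excludes only the zero space, which has
no states.) -/
structure OrderUnitSpace : Type (u + 1) where
  carrier : Type u
  [addCommGroup : AddCommGroup carrier]
  [module : Module ℝ carrier]
  [partialOrder : PartialOrder carrier]
  [isOrderedAddMonoid : IsOrderedAddMonoid carrier]
  [posSMulMono : PosSMulMono ℝ carrier]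
  unit : carrier
  unit_pos : 0 < unit
  exists_le_smul_unit : ∀ a : carrier, ∃ r : ℝ, a ≤ r • unit
  le_zero_of_forall_le : ∀ a : carrier, (∀ r : ℝ, 0 < r → a ≤ r • unit) → a ≤ 0

namespace OrderUnitSpace

instance : CoeSort OrderUnitSpace.{u} (Type u) := ⟨OrderUnitSpace.carrier⟩

attribute [instance] addCommGroup module partialOrder isOrderedAddMonoid posSMulMono

variable (A : OrderUnitSpace.{u})

/-- The order-unit norm `‖a‖ = inf {r : -r e ≤ a ≤ r e}`. -/
noncomputable instance instNorm : Norm A :=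
  ⟨fun a => sInf {r : ℝ | (-r) • A.unit ≤ a ∧ a ≤ r • A.unit}⟩

variable {A}

theorem norm_def (a : A) : ‖a‖ = sInf {r : ℝ | (-r) • A.unit ≤ a ∧ a ≤ r • A.unit} := rfl

theorem smul_unit_le {r s : ℝ} (h : r ≤ s) : r • A.unit ≤ s • A.unit := by
  have h1 : 0 ≤ (s - r) • A.unit := smul_nonneg (sub_nonneg.2 h) A.unit_pos.le
  rw [sub_smul] at h1
  exact sub_nonneg.1 h1

theorem nonneg_of_bound {r : ℝ} {a : A} (h1 : (-r) • A.unit ≤ a) (h2 : a ≤ r • A.unit) :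
    0 ≤ r := by
  by_contra hr
  push Not at hr
  have h3 : (-r) • A.unit ≤ r • A.unit := h1.trans h2
  have h4 : r • A.unit ≤ 0 := by simpa using smul_unit_le (A := A) hr.le
  have h5 : 0 ≤ (-r) • A.unit := smul_nonneg (by linarith) A.unit_pos.le
  have h6 : r • A.unit = 0 := le_antisymm h4 (h5.trans h3)
  rcases smul_eq_zero.1 h6 with h | h
  · exact hr.ne h
  · exact A.unit_pos.ne' h

theorem bddBelow_bounds (a : A) :
    BddBelow {r : ℝ | (-r) • A.unit ≤ a ∧ a ≤ r • A.unit} :=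
  ⟨0, fun _ hr => nonneg_of_bound hr.1 hr.2⟩

theorem bounds_nonempty (a : A) :
    {r : ℝ | (-r) • A.unit ≤ a ∧ a ≤ r • A.unit}.Nonempty := by
  obtain ⟨r, hr⟩ := A.exists_le_smul_unit a
  obtain ⟨s, hs⟩ := A.exists_le_smul_unit (-a)
  refine ⟨max r s, ?_, hr.trans (smul_unit_le (le_max_left r s))⟩
  have h := hs.trans (smul_unit_le (A := A) (le_max_right r s))
  rw [neg_smul]
  exact neg_le.1 h

theorem norm_le_of_bound {r : ℝ} {a : A} (h1 : (-r) • A.unit ≤ a) (h2 : a ≤ r • A.unit) :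
    ‖a‖ ≤ r := csInf_le (bddBelow_bounds a) ⟨h1, h2⟩

theorem le_norm_smul_unit (a : A) : a ≤ ‖a‖ • A.unit := by
  rw [← sub_nonpos]
  refine A.le_zero_of_forall_le _ fun ε hε => ?_
  obtain ⟨r, hr, hlt⟩ := exists_lt_of_csInf_lt (bounds_nonempty a) (lt_add_of_pos_right ‖a‖ hε)
  rw [sub_le_iff_le_add', ← add_smul]
  exact hr.2.trans (smul_unit_le hlt.le)

theorem norm_neg_eq (a : A) : ‖-a‖ = ‖a‖ := by
  simp only [norm_def]
  congr 1
  ext r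
  simp only [Set.mem_ofPred_eq, neg_smul, neg_le_neg_iff]
  rw [neg_le, and_comm]

theorem neg_norm_smul_unit_le (a : A) : (-‖a‖) • A.unit ≤ a := by
  have h := le_norm_smul_unit (-a)
  rw [norm_neg_eq] at h
  rw [neg_smul]
  exact neg_le.1 h

theorem norm_nonneg' (a : A) : 0 ≤ ‖a‖ :=
  nonneg_of_bound (neg_norm_smul_unit_le a) (le_norm_smul_unit a)

theorem norm_smul_le' (c : ℝ) (a : A) : ‖c • a‖ ≤ |c| * ‖a‖ := by
  have key : ∀ c : ℝ, 0 ≤ c → ∀ a : A, ‖c • a‖ ≤ c * ‖a‖ := by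
    intro c hc a
    apply norm_le_of_bound
    · have h := smul_le_smul_of_nonneg_left (neg_norm_smul_unit_le a) hc
      rwa [smul_smul, mul_neg] at h
    · have h := smul_le_smul_of_nonneg_left (le_norm_smul_unit a) hc
      rwa [smul_smul] at h
  rcases le_total 0 c with hc | hc
  · rw [abs_of_nonneg hc]
    exact key c hc a
  · rw [abs_of_nonpos hc, ← norm_neg_eq, ← neg_smul]
    exact key (-c) (by linarith) a

theorem normedSpaceCore (A : OrderUnitSpace.{u}) : NormedSpace.Core ℝ A where
  norm_nonneg := norm_nonneg'
  norm_smul c a := by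
    rw [Real.norm_eq_abs]
    refine le_antisymm (norm_smul_le' c a) ?_
    rcases eq_or_ne c 0 with rfl | hc
    · simpa using norm_nonneg' ((0 : ℝ) • a)
    · have h := norm_smul_le' c⁻¹ (c • a)
      rw [smul_smul, inv_mul_cancel₀ hc, one_smul, abs_inv] at h
      have hpos : 0 < |c| := abs_pos.2 hc
      calc |c| * ‖a‖ ≤ |c| * (|c|⁻¹ * ‖c • a‖) := by gcongr
        _ = ‖c • a‖ := by field_simp
  norm_triangle a b := by
    apply norm_le_of_bound
    · rw [neg_add, add_smul]
      exact add_le_add (neg_norm_smul_unit_le a) (neg_norm_smul_unit_le b)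
    · rw [add_smul]
      exact add_le_add (le_norm_smul_unit a) (le_norm_smul_unit b)
  norm_eq_zero_iff a := by
    constructor
    · intro h
      have h1 := le_norm_smul_unit a
      have h2 := neg_norm_smul_unit_le a
      rw [h] at h1 h2
      exact le_antisymm (by simpa using h1) (by simpa using h2)
    · rintro rfl
      exact le_antisymm (norm_le_of_bound (by simp) (by simp)) (norm_nonneg' 0)

noncomputable instance instNormedAddCommGroup (A : OrderUnitSpace.{u}) : NormedAddCommGroup A :=
  NormedAddCommGroup.ofCore A.normedSpaceCore

noncomputable instance instNormedSpace (A : OrderUnitSpace.{u}) : NormedSpace ℝ A :=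
  NormedSpace.ofCore A.normedSpaceCore

/-- The state space `S(A)`: all bounded linear functionals `μ` with `μ(e) = 1 = ‖μ‖`, with the
weak-* topology (the topology inherited from `WeakDual ℝ A`). -/
abbrev StateSpace (A : OrderUnitSpace.{u}) : Type u :=
  {μ : WeakDual ℝ A // μ A.unit = 1 ∧ ‖WeakDual.toStrongDual μ‖ = 1}

/-- The extended metric `ρ_L(μ, ν) = sup {|μ(a) - ν(a)| : L(a) ≤ 1}` on the state space. -/
noncomputable def rho (L : Seminorm ℝ A) (μ ν : A.StateSpace) : ℝ≥0∞ :=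
  ⨆ (a : A) (_ : L a ≤ 1), ENNReal.ofReal |μ.1 a - ν.1 a|

/-- `ρ_L` as an extended pseudometric structure; its topology is the one generated by the
`ρ_L`-balls. -/
noncomputable abbrev rhoPseudoEMetric (L : Seminorm ℝ A) : PseudoEMetricSpace A.StateSpace where
  edist := rho L
  edist_self μ := by simp [rho]
  edist_comm μ ν := by simp only [rho, abs_sub_comm]
  edist_triangle μ ν σ := by
    refine iSup₂_le fun a ha => ?_
    calc ENNReal.ofReal |μ.1 a - σ.1 a|
        ≤ ENNReal.ofReal (|μ.1 a - ν.1 a| + |ν.1 a - σ.1 a|) :=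
          ENNReal.ofReal_le_ofReal (abs_sub_le _ _ _)
      _ ≤ ENNReal.ofReal |μ.1 a - ν.1 a| + ENNReal.ofReal |ν.1 a - σ.1 a| :=
          ENNReal.ofReal_add_le
      _ ≤ rho L μ ν + rho L ν σ :=
          add_le_add (le_iSup₂_of_le a ha le_rfl) (le_iSup₂_of_le a ha le_rfl)

/-- A Lip-norm on an order-unit space: a seminorm vanishing exactly on the multiples of the order
unit whose metric `ρ_L` induces the weak-* topology on the state space. -/
structure IsLipNorm (L : Seminorm ℝ A) : Prop where
  eq_zero_iff : ∀ a : A, L a = 0 ↔ ∃ r : ℝ, a = r • A.unit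
  topology_eq : (rhoPseudoEMetric L).toUniformSpace.toTopologicalSpace =
    (inferInstance : TopologicalSpace A.StateSpace)

/-- The direct sum `A ⊕ B` with componentwise order and order unit `(e_A, e_B)`. -/
def prod (A B : OrderUnitSpace.{u}) : OrderUnitSpace.{u} where
  carrier := A × B
  posSMulMono := ⟨fun _ hr _ _ h => Prod.mk_le_mk.2
    ⟨smul_le_smul_of_nonneg_left h.1 hr, smul_le_smul_of_nonneg_left h.2 hr⟩⟩
  unit := (A.unit, B.unit)
  unit_pos := lt_of_le_of_ne ⟨A.unit_pos.le, B.unit_pos.le⟩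
    fun h => A.unit_pos.ne (congrArg Prod.fst h)
  exists_le_smul_unit := fun p => by
    obtain ⟨r, hr⟩ := A.exists_le_smul_unit p.1
    obtain ⟨s, hs⟩ := B.exists_le_smul_unit p.2
    exact ⟨max r s, hr.trans (smul_unit_le (le_max_left r s)),
      hs.trans (smul_unit_le (le_max_right r s))⟩
  le_zero_of_forall_le := fun p h =>
    ⟨A.le_zero_of_forall_le p.1 fun r hr => (h r hr).1,
      B.le_zero_of_forall_le p.2 fun r hr => (h r hr).2⟩

/-- The projection `A ⊕ B → A`. -/
def prodFst (A B : OrderUnitSpace.{u}) : A.prod B →ₗ[ℝ] A where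
  toFun p := p.1
  map_add' _ _ := rfl
  map_smul' _ _ := rfl

/-- The projection `A ⊕ B → B`. -/
def prodSnd (A B : OrderUnitSpace.{u}) : A.prod B →ₗ[ℝ] B where
  toFun p := p.2
  map_add' _ _ := rfl
  map_smul' _ _ := rfl

/-- For a surjection `π : C → A`, the seminorm `L` on `C` induces `L_A` on `A` if `L_A` is the
quotient seminorm `L_A(a) = inf {L(c) : π(c) = a}`. -/
def Induces {C A : OrderUnitSpace.{u}} (π : C →ₗ[ℝ] A) (L : Seminorm ℝ C) (LA : Seminorm ℝ A) :
    Prop :=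
  ∀ a : A, LA a = sInf (L '' {c : C | π c = a})

/-- The image of `S(A)` in `S(C)` under `μ ↦ μ ∘ π`. -/
def stateImage {C A : OrderUnitSpace.{u}} (π : C →ₗ[ℝ] A) : Set C.StateSpace :=
  {σ | ∃ μ : A.StateSpace, ∀ c : C, σ.1 c = μ.1 (π c)}

/-- The set `𝓜(L_A, L_B)` of Lip-norms on `A ⊕ B` which induce `L_A` and `L_B`. -/
def lipNormsInducing {A B : OrderUnitSpace.{u}} (LA : Seminorm ℝ A) (LB : Seminorm ℝ B) :
    Set (Seminorm ℝ (A.prod B)) :=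
  {L | IsLipNorm L ∧ Induces (prodFst A B) L LA ∧ Induces (prodSnd A B) L LB}

end OrderUnitSpace

/-- A compact quantum metric space: an order-unit space with a Lip-norm. -/
structure CompactQuantumMetricSpace : Type (u + 1) where
  space : OrderUnitSpace.{u}
  lip : Seminorm ℝ space
  isLipNorm : OrderUnitSpace.IsLipNorm lip

namespace CompactQuantumMetricSpace

open OrderUnitSpace

/-- The quantum Gromov-Hausdorff distance: the infimum over `L ∈ 𝓜(L_A, L_B)` of the Hausdorff
distance for `ρ_L` between `S(A)` and `S(B)`, viewed as subsets of `S(A ⊕ B)`. -/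
noncomputable def qDist (A B : CompactQuantumMetricSpace.{u}) : ℝ≥0∞ :=
  ⨅ L ∈ lipNormsInducing A.lip B.lip,
    @Metric.hausdorffEDist _ (rhoPseudoEMetric L)
      (stateImage (prodFst A.space B.space)) (stateImage (prodSnd A.space B.space))

/-- The norm completion `Ā` of `A`. -/
abbrev Completion (A : CompactQuantumMetricSpace.{u}) : Type u :=
  UniformSpace.Completion A.space

/-- The closure in `Ā` of the unit ball `{a : L(a) ≤ 1}`: the unit ball of the closed Lip-norm
`L^c`. -/
def closedLipBall (A : CompactQuantumMetricSpace.{u}) : Set A.Completion :=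
  closure ((fun a : A.space => (a : A.Completion)) '' {a | A.lip a ≤ 1})

/-- The underlying space `A^c ⊆ Ā` of the closure of `(A, L)`: the elements of `Ā` on which `L^c`
is finite, that is, the linear span of the (closed absolutely convex) unit ball of `L^c`. -/
noncomputable def lipClosure (A : CompactQuantumMetricSpace.{u}) : Submodule ℝ A.Completion :=
  Submodule.span ℝ A.closedLipBall

/-- The closed Lip-norm `L^c` on `A^c`: the Minkowski functional of its unit ball. -/
noncomputable def closedLip (A : CompactQuantumMetricSpace.{u}) (x : A.lipClosure) : ℝ :=
  gauge A.closedLipBall (x : A.Completion)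

/-- The positive cone of the completion `Ā`: the closure of the positive cone of `A`. -/
def completionCone (A : CompactQuantumMetricSpace.{u}) : Set A.Completion :=
  closure ((fun a : A.space => (a : A.Completion)) '' {a | 0 ≤ a})

/-- The order unit, as an element of `A^c`. -/
noncomputable def closureUnit (A : CompactQuantumMetricSpace.{u}) : A.lipClosure :=
  ⟨(A.space.unit : A.Completion), Submodule.subset_span (subset_closure
    ⟨A.space.unit, by
      have h : A.lip A.space.unit = 0 := (A.isLipNorm.eq_zero_iff _).2 ⟨1, (one_smul ℝ _).symm⟩
      simp [h], rfl⟩)⟩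

/-- An isometry from `(A, L_A)` to `(B, L_B)`: an isomorphism `φ` of order-unit spaces from `A^c`
onto `B^c` (linear, bijective, order preserving in both directions, unit preserving) such that
`L_A^c = L_B^c ∘ φ`. -/
structure Isometry (A B : CompactQuantumMetricSpace.{u}) where
  toLinearEquiv : A.lipClosure ≃ₗ[ℝ] B.lipClosure
  map_cone_iff : ∀ x : A.lipClosure,
    (toLinearEquiv x : B.Completion) ∈ B.completionCone ↔ (x : A.Completion) ∈ A.completionCone
  map_unit : toLinearEquiv A.closureUnit = B.closureUnit
  closedLip_map : ∀ x : A.lipClosure, B.closedLip (toLinearEquiv x) = A.closedLip x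

/-- The relation of being isometric. -/
def isometrySetoid : Setoid CompactQuantumMetricSpace.{u} where
  r A B := Nonempty (Isometry A B)
  iseqv :=
    { refl := fun A => ⟨⟨LinearEquiv.refl ℝ _, fun _ => Iff.rfl, rfl, fun _ => rfl⟩⟩
      symm := by
        rintro A B ⟨φ⟩
        refine ⟨⟨φ.toLinearEquiv.symm, fun x => ?_, ?_, fun x => ?_⟩⟩
        · have h := φ.map_cone_iff (φ.toLinearEquiv.symm x)
          rw [LinearEquiv.apply_symm_apply] at h
          exact h.symm
        · rw [LinearEquiv.symm_apply_eq]
          exact φ.map_unit.symm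
        · have h := φ.closedLip_map (φ.toLinearEquiv.symm x)
          rw [LinearEquiv.apply_symm_apply] at h
          exact h.symm
      trans := by
        rintro A B C ⟨φ⟩ ⟨ψ⟩
        refine ⟨⟨φ.toLinearEquiv.trans ψ.toLinearEquiv, fun x => ?_, ?_, fun x => ?_⟩⟩
        · exact (ψ.map_cone_iff _).trans (φ.map_cone_iff x)
        · rw [LinearEquiv.trans_apply, φ.map_unit, ψ.map_unit]
        · exact (ψ.closedLip_map _).trans (φ.closedLip_map x) }

/-- The set of isometry classes of compact quantum metric spaces. -/
def IsometryClass : Type (u + 1) := Quotient isometrySetoid.{u}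

/-- The isometry class of a compact quantum metric space. -/
def isometryClass (A : CompactQuantumMetricSpace.{u}) : IsometryClass.{u} :=
  Quotient.mk isometrySetoid A

end CompactQuantumMetricSpace

section

open Filter Topology

/-! ### Norm, positivity and states of an order-unit space -/

namespace OrderUnitSpace

variable {A B C : OrderUnitSpace.{u}}

/-! The whole proof replaces Lip-norms on `A ⊕ B` by correspondences (`IsCorr`): convex symmetric
sets `U` of pairs from the two Lip-balls, invariant under adding a common scalar, in which every
element of an open Lip-ball has a partner, and such that partners have the same order properties up
to an error `r`. The distance is the infimum of the possible `r`. If `L` is admissible and the two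
state spaces are closer than `r` for `ρ_L`, then `{L ≤ 1}` is a correspondence, since states detect
positivity (`isCorr_of_hausdorffEDist_lt`). Conversely, a slight fattening of `U` is absorbent and
its gauge is an admissible Lip-norm; a Hahn–Banach argument (`IsCorr.exists_state`) turns order
preservation up to `r` into a nearby state (`qDist_le_of_isCorr`). That the gauge is a Lip-norm
follows from Rieffel's criterion: `L` is a Lip-norm exactly when it vanishes only on scalars and its
unit ball is bounded modulo scalars, with totally bounded norm-bounded parts.

Correspondences can be reversed and composed with addition of errors, which gives symmetry and the
triangle inequality. Fixing one state on each side and pairing elements with equal values gives some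
correspondence, so the distance is finite. An isometry of the closures gives correspondences of
every positive error, so isometric spaces are at distance zero.

If the distance is zero, choose correspondences with errors tending to zero. Compactness of the
Lip-balls makes partners converge along an ultrafilter, and the limit relation is the graph of an
isometry from `A^c` onto `B^c` (`nonempty_isometry_of_isCorr`).

For completeness it suffices to treat a sequence whose consecutive distances are less than `2⁻ⁿ`.
Fix correspondences between neighbours and consider the threads, the sequences of successive
partners. Their span, ordered by asymptotic positivity and divided by the sequences that vanish
asymptotically, is an order-unit space; the gauge of the set of threads is its Lip-norm; and pairing
the `n`-th term of a thread with its class is a correspondence whose error is the sum of the later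
errors (`isCorr_limit`). -/

theorem norm_le_iff {a : A} {r : ℝ} :
    ‖a‖ ≤ r ↔ 0 ≤ a + r • A.unit ∧ 0 ≤ -a + r • A.unit := by
  constructor
  · intro h
    constructor
    · have h1 := (smul_unit_le (A := A) (neg_le_neg h)).trans (neg_norm_smul_unit_le a)
      rw [neg_smul] at h1
      simpa using sub_nonneg.2 h1
    · have h1 := (le_norm_smul_unit a).trans (smul_unit_le h)
      rw [neg_add_eq_sub]
      exact sub_nonneg.2 h1
  · rintro ⟨h1, h2⟩
    apply norm_le_of_bound
    · rw [neg_smul]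
      exact sub_nonneg.1 (by simpa using h1)
    · rw [neg_add_eq_sub] at h2
      exact sub_nonneg.1 h2

theorem norm_unit : ‖A.unit‖ = 1 := by
  apply le_antisymm
  · rw [norm_le_iff]
    simp only [one_smul, neg_add_cancel, le_refl, and_true]
    exact add_nonneg A.unit_pos.le A.unit_pos.le
  · have h := le_norm_smul_unit A.unit
    by_contra hlt
    push Not at hlt
    have h1 : 0 ≤ (‖A.unit‖ - 1) • A.unit := by
      rw [sub_smul, one_smul]; exact sub_nonneg.2 h
    have h2 : 0 ≤ (1 - ‖A.unit‖) • A.unit := smul_nonneg (by linarith) A.unit_pos.le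
    have h3 : (1 - ‖A.unit‖) • A.unit = 0 :=
      le_antisymm (by rw [← neg_sub, neg_smul]; exact neg_nonpos.2 h1) h2
    rcases smul_eq_zero.1 h3 with h | h
    · linarith
    · exact A.unit_pos.ne' h

theorem nonneg_of_smul_unit_nonneg {r : ℝ} (h : 0 ≤ r • A.unit) : 0 ≤ r := by
  by_contra hr
  push Not at hr
  have h2 : 0 ≤ (-r) • A.unit := smul_nonneg (by linarith) A.unit_pos.le
  have h3 : r • A.unit = 0 := le_antisymm (by simpa using h2) h
  rcases smul_eq_zero.1 h3 with h | h
  · linarith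
  · exact A.unit_pos.ne' h

theorem nonneg_of_forall_pos {a : A} (h : ∀ ε : ℝ, 0 < ε → 0 ≤ a + ε • A.unit) : 0 ≤ a := by
  have := A.le_zero_of_forall_le (-a) fun r hr => by
    have := h r hr
    rw [← sub_nonneg]
    simpa [add_comm] using this
  simpa using this

theorem nonneg_mono {a : A} {r s : ℝ} (h : 0 ≤ a + r • A.unit) (hrs : r ≤ s) :
    0 ≤ a + s • A.unit :=
  h.trans (add_le_add_right (smul_unit_le hrs) _)

theorem norm_apply_le_of_positive (f : A →ₗ[ℝ] ℝ) (hf : ∀ a, 0 ≤ a → 0 ≤ f a)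
    (h1 : f A.unit = 1) (a : A) : ‖f a‖ ≤ 1 * ‖a‖ := by
  obtain ⟨h2, h3⟩ := norm_le_iff.1 (le_refl ‖a‖)
  have h2 := hf _ h2
  have h3 := hf _ h3
  simp only [map_add, map_neg, map_smul, h1, smul_eq_mul, mul_one] at h2 h3
  rw [Real.norm_eq_abs, abs_le]
  constructor <;> linarith

/-- Every positive unital functional is a state. -/
noncomputable def stateOfPositive (f : A →ₗ[ℝ] ℝ) (hf : ∀ a, 0 ≤ a → 0 ≤ f a)
    (h1 : f A.unit = 1) : A.StateSpace :=
  ⟨StrongDual.toWeakDual (f.mkContinuous 1 (norm_apply_le_of_positive f hf h1)), h1, by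
    apply le_antisymm
    · exact LinearMap.mkContinuous_norm_le f zero_le_one (norm_apply_le_of_positive f hf h1)
    · have := (f.mkContinuous 1 (norm_apply_le_of_positive f hf h1)).le_opNorm A.unit
      rw [norm_unit, mul_one] at this
      refine le_trans ?_ this
      simp [h1]⟩

namespace StateSpace

variable (μ : A.StateSpace)

theorem abs_apply_le (a : A) : |μ.1 a| ≤ ‖a‖ := by
  have := (WeakDual.toStrongDual μ.1).le_opNorm a
  rwa [μ.2.2, one_mul] at this

theorem nonneg {a : A} (h : 0 ≤ a) : 0 ≤ μ.1 a := by
  have h1 : ‖‖a‖ • A.unit - a‖ ≤ ‖a‖ := by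
    rw [norm_le_iff]
    constructor
    · have := sub_nonneg.2 (le_norm_smul_unit a)
      exact add_nonneg this (smul_nonneg (norm_nonneg a) A.unit_pos.le)
    · simpa using h
  have h2 := (μ.abs_apply_le _).trans h1
  rw [map_sub, map_smul, μ.2.1, abs_le, smul_eq_mul, mul_one] at h2
  linarith [h2.2]

end StateSpace

/-- A convex cone that contains the positive cone but no negative multiple of the order unit is
nonnegative at some state. -/
theorem exists_state_nonneg (s : PointedCone ℝ A) (hs : ∀ a, 0 ≤ a → a ∈ s)
    (h : ∀ r : ℝ, r • A.unit ∈ s → 0 ≤ r) : ∃ ν : A.StateSpace, ∀ x ∈ s, 0 ≤ ν.1 x := by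
  have hne : A.unit ≠ 0 := A.unit_pos.ne'
  -- The functional `r • e ↦ r` on the line through the unit is nonnegative on the cone; the order
  -- unit supplies the cofinality that the extension needs.
  obtain ⟨g, hg, hgs⟩ := riesz_extension s
    (LinearPMap.mkSpanSingleton (σ := RingHom.id ℝ) A.unit (1 : ℝ) hne) (by
      rintro ⟨x, hx⟩ hxs
      obtain ⟨r, rfl⟩ := Submodule.mem_span_singleton.1 hx
      have := LinearPMap.mkSpanSingleton'_apply (σ := RingHom.id ℝ) A.unit (1 : ℝ)
        (fun c hc => by simp [(smul_eq_zero.1 hc).resolve_right hne]) r hx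
      simp only [LinearPMap.mkSpanSingleton]
      rw [this]
      simpa using h r hxs) (by
      intro y
      obtain ⟨r, hr⟩ := A.exists_le_smul_unit (-y)
      refine ⟨⟨r • A.unit, Submodule.mem_span_singleton.2 ⟨r, rfl⟩⟩, hs _ ?_⟩
      have := sub_nonneg.2 hr
      simpa using this)
  have hu : g A.unit = 1 := by
    have h1 := hg ⟨A.unit, Submodule.mem_span_singleton_self _⟩
    have := LinearPMap.mkSpanSingleton'_apply (σ := RingHom.id ℝ) A.unit (1 : ℝ)
        (fun c hc => by simp [(smul_eq_zero.1 hc).resolve_right hne]) 1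
        (by rw [one_smul]; exact Submodule.mem_span_singleton_self _)
    simp only [one_smul] at this
    rw [h1]
    simpa [LinearPMap.mkSpanSingleton] using this
  exact ⟨stateOfPositive g (fun a ha => hgs a (hs a ha)) hu, hgs⟩

/-- If `b + ε e` were not positive, the cone generated by the positive cone and `-(b + ε e)` would
contain no negative multiple of `e`, and a state nonnegative on it would be at most `-ε` at `b`. The
Archimedean axiom then removes `ε`. -/
theorem nonneg_of_forall_state {b : A} (h : ∀ ν : A.StateSpace, 0 ≤ ν.1 b) : 0 ≤ b := by
  refine nonneg_of_forall_pos fun ε hε => ?_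
  by_contra hb
  let s : PointedCone ℝ A :=
    { carrier := {x | ∃ t : ℝ, 0 ≤ t ∧ 0 ≤ x + t • (b + ε • A.unit)}
      zero_mem' := ⟨0, le_rfl, by simp⟩
      add_mem' := by
        rintro x y ⟨t, ht, hx⟩ ⟨t', ht', hy⟩
        refine ⟨t + t', add_nonneg ht ht', ?_⟩
        rw [add_smul, add_add_add_comm]
        exact add_nonneg hx hy
      smul_mem' := by
        rintro ⟨c, hc⟩ x ⟨t, ht, hx⟩
        refine ⟨c * t, mul_nonneg hc ht, ?_⟩
        rw [mul_smul]
        have := smul_nonneg hc hx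
        rwa [smul_add] at this }
  obtain ⟨ν, hν⟩ := exists_state_nonneg s (fun a ha => ⟨0, le_rfl, by simpa using ha⟩) (by
    rintro r ⟨t, ht, hr⟩
    by_contra hr0
    push Not at hr0
    rcases ht.eq_or_lt with rfl | ht
    · exact hr0.not_ge (nonneg_of_smul_unit_nonneg (by simpa using hr))
    · apply hb
      have h1 : 0 ≤ t • (b + ε • A.unit) := by
        have h2 : 0 ≤ (-r) • A.unit := smul_nonneg (by linarith) A.unit_pos.le
        have := add_nonneg h2 hr
        simpa using this
      have := smul_nonneg (inv_nonneg.2 ht.le) h1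
      rwa [smul_smul, inv_mul_cancel₀ ht.ne', one_smul] at this)
  have h1 := hν (-(b + ε • A.unit)) ⟨1, zero_le_one, by simp⟩
  rw [map_neg, map_add, map_smul, ν.2.1, smul_eq_mul, mul_one] at h1
  linarith [h ν]

theorem exists_state : Nonempty A.StateSpace := by
  by_contra h
  have : (0 : A) ≤ -A.unit := nonneg_of_forall_state fun ν => (h ⟨ν⟩).elim
  exact A.unit_pos.not_ge (by simpa using this)

theorem norm_le_of_forall_state {a : A} {r : ℝ} (h : ∀ ν : A.StateSpace, |ν.1 a| ≤ r) :
    ‖a‖ ≤ r := by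
  rw [norm_le_iff]
  constructor <;> refine nonneg_of_forall_state fun ν => ?_
  · rw [map_add, map_smul, ν.2.1, smul_eq_mul, mul_one]
    linarith [(abs_le.1 (h ν)).1]
  · rw [map_add, map_smul, ν.2.1, smul_eq_mul, mul_one, map_neg]
    linarith [(abs_le.1 (h ν)).2]

end OrderUnitSpace

/-! ### Lip-norms and total boundedness of Lip-balls -/

/-- Finite colourings with small colour classes need no centres, so they can be pulled back along
maps that are only approximately isometric and combined in products. -/
theorem totallyBounded_iff_exists_coloring {X : Type u} [PseudoMetricSpace X] {s : Set X} :
    TotallyBounded s ↔ ∀ ε : ℝ, 0 < ε → ∃ (ι : Type u) (c : X → ι), (c '' s).Finite ∧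
      ∀ x ∈ s, ∀ y ∈ s, c x = c y → dist x y ≤ ε := by
  classical
  constructor
  · intro h ε hε
    obtain ⟨t, ht, hst⟩ := Metric.totallyBounded_iff.1 h (ε / 2) (half_pos hε)
    have h1 : ∀ x ∈ s, ∃ y ∈ t, dist x y < ε / 2 := fun x hx => by
      simpa using hst hx
    choose! c hct hc using h1
    refine ⟨X, c, ht.subset (Set.image_subset_iff.2 hct), fun x hx y hy hxy => ?_⟩
    have h2 := dist_triangle_right x y (c x)
    have h3 := hc x hx
    have h4 := hc y hy
    rw [← hxy] at h4
    linarith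
  · intro h
    rw [Metric.totallyBounded_iff]
    intro ε hε
    rcases s.eq_empty_or_nonempty with rfl | ⟨x₀, hx₀⟩
    · exact ⟨∅, Set.finite_empty, by simp⟩
    have : Nonempty X := ⟨x₀⟩
    obtain ⟨ι, c, hc, hcs⟩ := h (ε / 2) (half_pos hε)
    refine ⟨Function.invFunOn c s '' (c '' s), hc.image _, fun x hx => ?_⟩
    simp only [Set.mem_iUnion]
    have hmem : c x ∈ c '' s := ⟨x, hx, rfl⟩
    refine ⟨_, ⟨c x, hmem, rfl⟩, ?_⟩
    rw [Metric.mem_ball]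
    have := hcs x hx _ (Function.invFunOn_mem hmem) (Function.invFunOn_eq hmem).symm
    linarith

namespace OrderUnitSpace

variable {A B C : OrderUnitSpace.{u}}

/-- Banach–Alaoglu: given `μ(e) = 1`, the condition `‖μ‖ = 1` amounts to the weak-* closed condition
`‖μ‖ ≤ 1`, because `‖e‖ = 1`. -/
instance : CompactSpace A.StateSpace := by
  have : {μ : WeakDual ℝ A | μ A.unit = 1 ∧ ‖WeakDual.toStrongDual μ‖ = 1} =
      WeakDual.toStrongDual ⁻¹' Metric.closedBall 0 1 ∩ {μ | μ A.unit = 1} := by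
    ext μ
    simp only [Set.mem_ofPred_eq, Set.mem_inter_iff, Set.mem_preimage, mem_closedBall_zero_iff]
    constructor
    · rintro ⟨h1, h2⟩
      exact ⟨h2.le, h1⟩
    · rintro ⟨h1, h2⟩
      refine ⟨h2, le_antisymm h1 ?_⟩
      have := (WeakDual.toStrongDual μ).le_opNorm A.unit
      rw [norm_unit, mul_one] at this
      refine le_trans ?_ this
      simp [h2]
  have hc : IsClosed {μ : WeakDual ℝ A | μ A.unit = 1} :=
    isClosed_singleton.preimage (WeakDual.eval_continuous A.unit)
  have h := (WeakDual.isCompact_closedBall (𝕜 := ℝ) (E := A) 0 1).inter_right hc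
  rw [← this] at h
  exact isCompact_iff_compactSpace.1 h

theorem ofReal_abs_le_rho {L : Seminorm ℝ A} {a : A} (h : L a ≤ 1) (μ ν : A.StateSpace) :
    ENNReal.ofReal |μ.1 a - ν.1 a| ≤ rho L μ ν :=
  le_iSup₂_of_le (f := fun (a : A) (_ : L a ≤ 1) => ENNReal.ofReal |μ.1 a - ν.1 a|) a h le_rfl

theorem rho_le {L : Seminorm ℝ A} {μ ν : A.StateSpace} {r : ℝ}
    (h : ∀ a, L a ≤ 1 → |μ.1 a - ν.1 a| ≤ r) : rho L μ ν ≤ ENNReal.ofReal r :=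
  iSup₂_le fun a ha => ENNReal.ofReal_le_ofReal (h a ha)

theorem abs_sub_le_of_rho_le {L : Seminorm ℝ A} {μ ν : A.StateSpace} {r : ℝ} (hr : 0 ≤ r)
    (h : rho L μ ν ≤ ENNReal.ofReal r) {a : A} (ha : L a ≤ 1) : |μ.1 a - ν.1 a| ≤ r :=
  (ENNReal.ofReal_le_ofReal_iff hr).1 ((ofReal_abs_le_rho ha μ ν).trans h)

/-- The convex combination `(1 - t) μ + t ν` of two states. -/
noncomputable def segmentState (μ ν : A.StateSpace) (t : ℝ) (h0 : 0 ≤ t) (h1 : t ≤ 1) :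
    A.StateSpace :=
  stateOfPositive ((1 - t) • (WeakDual.toStrongDual μ.1).toLinearMap +
      t • (WeakDual.toStrongDual ν.1).toLinearMap)
    (fun a ha => add_nonneg (mul_nonneg (sub_nonneg.2 h1) (μ.nonneg ha))
      (mul_nonneg h0 (ν.nonneg ha)))
    (by
      have h1 := μ.2.1
      have h2 := ν.2.1
      simp [h1, h2])

theorem segmentState_apply (μ ν : A.StateSpace) (t : ℝ) (h0 : 0 ≤ t) (h1 : t ≤ 1) (a : A) :
    (segmentState μ ν t h0 h1).1 a = (1 - t) * μ.1 a + t * ν.1 a := rfl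

theorem tendsto_state_iff {ι : Type*} {l : Filter ι} {f : ι → A.StateSpace} {μ : A.StateSpace} :
    Tendsto f l (𝓝 μ) ↔ ∀ a, Tendsto (fun i => (f i).1 a) l (𝓝 (μ.1 a)) := by
  rw [tendsto_subtype_rng]
  exact WeakBilin.tendsto_iff_forall_eval_tendsto _ ContinuousLinearMap.coe_injective

namespace IsLipNorm

variable {L : Seminorm ℝ A}

theorem lip_smul_unit (h : IsLipNorm L) (r : ℝ) : L (r • A.unit) = 0 :=
  (h.eq_zero_iff _).2 ⟨r, rfl⟩

theorem nhds_eq (h : IsLipNorm L) (μ : A.StateSpace) :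
    @nhds _ (rhoPseudoEMetric L).toUniformSpace.toTopologicalSpace μ = 𝓝 μ := by
  rw [h.topology_eq]

theorem eventually_rho_lt (h : IsLipNorm L) (μ : A.StateSpace) {ε : ℝ≥0∞} (hε : 0 < ε) :
    ∀ᶠ ν in 𝓝 μ, rho L ν μ < ε := by
  rw [← h.nhds_eq μ]
  exact @Metric.eball_mem_nhds _ (rhoPseudoEMetric L) μ ε hε

/-- The states at parameter `1 / (n + 1)` on the segment from `μ` to `ν` converge weak-* to `μ`,
hence also for `ρ_L`. One of them is within `1` of `μ`, and distances along a segment scale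
linearly. -/
theorem rho_lt_top (h : IsLipNorm L) (μ ν : A.StateSpace) : rho L μ ν < ∞ := by
  have ht : ∀ n : ℕ, (1 : ℝ) / (n + 1) ≤ 1 := fun n => by
    rw [div_le_one (by positivity)]; linarith [n.cast_nonneg (α := ℝ)]
  have hlim : Tendsto (fun n : ℕ => segmentState μ ν (1 / (n + 1)) (by positivity) (ht n))
      atTop (𝓝 μ) := by
    rw [tendsto_state_iff]
    intro a
    simp only [segmentState_apply]
    have h1 := tendsto_one_div_add_atTop_nhds_zero_nat (𝕜 := ℝ)
    have h2 := ((tendsto_const_nhds (x := (1 : ℝ))).sub h1).mul_const (μ.1 a)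
    simpa using h2.add (h1.mul_const (ν.1 a))
  obtain ⟨n, hn⟩ := (hlim.eventually (h.eventually_rho_lt μ zero_lt_one)).exists
  have hn1 : rho L (segmentState μ ν (1 / (n + 1)) (by positivity) (ht n)) μ ≤
    ENNReal.ofReal 1 := by simpa using hn.le
  refine lt_of_le_of_lt (rho_le (r := n + 1) fun a ha => ?_) ENNReal.ofReal_lt_top
  have h1 := abs_sub_le_of_rho_le zero_le_one hn1 ha
  rw [segmentState_apply] at h1
  have h2 : (1 - 1 / ((n : ℝ) + 1)) * μ.1 a + 1 / (n + 1) * ν.1 a - μ.1 a =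
    -(1 / (n + 1)) * (μ.1 a - ν.1 a) := by ring
  rw [h2, abs_mul, abs_neg, abs_of_nonneg (by positivity), one_div_mul_eq_div,
    div_le_one (by positivity)] at h1
  exact h1

theorem exists_finite_net (h : IsLipNorm L) {ε : ℝ≥0∞} (hε : 0 < ε) :
    ∃ t : Finset A.StateSpace, ∀ μ, ∃ ν ∈ t, rho L μ ν < ε := by
  obtain ⟨t, -, ht⟩ := isCompact_univ.elim_nhds_subcover (fun μ : A.StateSpace => {ν | rho L ν μ < ε})
    (fun μ _ => h.eventually_rho_lt μ hε)
  refine ⟨t, fun μ => ?_⟩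
  have := ht (Set.mem_univ μ)
  simpa using this

theorem exists_radius (h : IsLipNorm L) : ∃ R : ℝ, 0 ≤ R ∧ ∀ μ ν : A.StateSpace, ∀ a, L a ≤ 1 →
    |μ.1 a - ν.1 a| ≤ R := by
  obtain ⟨t, ht⟩ := h.exists_finite_net zero_lt_one
  obtain ⟨μ₀⟩ := exists_state (A := A)
  have hR : ∃ R : ℝ, 0 ≤ R ∧ ∀ μ ∈ t, rho L μ μ₀ ≤ ENNReal.ofReal R := by
    refine ⟨∑ μ ∈ t, (rho L μ μ₀).toReal, Finset.sum_nonneg fun _ _ => ENNReal.toReal_nonneg,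
      fun μ hμ => ?_⟩
    rw [← ENNReal.ofReal_toReal (h.rho_lt_top μ μ₀).ne]
    exact ENNReal.ofReal_le_ofReal (Finset.single_le_sum
      (f := fun μ => (rho L μ μ₀).toReal) (fun _ _ => ENNReal.toReal_nonneg) hμ)
  obtain ⟨R, hR0, hR⟩ := hR
  have key : ∀ μ : A.StateSpace, ∀ a, L a ≤ 1 → |μ.1 a - μ₀.1 a| ≤ 1 + R := fun μ a ha => by
    obtain ⟨ν, hν, hμν⟩ := ht μ
    have h1 := abs_sub_le_of_rho_le zero_le_one (by simpa using hμν.le) ha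
    have h2 := abs_sub_le_of_rho_le hR0 (hR ν hν) ha
    exact (abs_sub_le _ _ _).trans (add_le_add h1 h2)
  refine ⟨(1 + R) + (1 + R), by positivity, fun μ ν a ha => ?_⟩
  have h1 := key ν a ha
  rw [abs_sub_comm] at h1
  exact (abs_sub_le _ (μ₀.1 a) _).trans (add_le_add (key μ a ha) h1)

theorem exists_norm_sub_le (h : IsLipNorm L) :
    ∃ R : ℝ, 0 ≤ R ∧ ∀ a, L a ≤ 1 → ∃ s : ℝ, ‖a - s • A.unit‖ ≤ R := by
  obtain ⟨R, hR0, hR⟩ := h.exists_radius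
  obtain ⟨μ₀⟩ := exists_state (A := A)
  refine ⟨R, hR0, fun a ha => ⟨μ₀.1 a, norm_le_of_forall_state fun ν => ?_⟩⟩
  simpa [ν.2.1] using hR ν μ₀ a ha

/-- Colour `a` by its values, rounded to multiples of `ε / 3`, at a finite `ρ_L`-net of states. At
any other state two elements of the same colour differ by at most one rounding error and two net
errors, and the norm is controlled by the values at states. -/
theorem totallyBounded (h : IsLipNorm L) (M : ℝ) : TotallyBounded {a : A | L a ≤ 1 ∧ ‖a‖ ≤ M} := by
  rw [totallyBounded_iff_exists_coloring]
  intro ε hε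
  have hε3 : 0 < ε / 3 := by positivity
  obtain ⟨t, ht⟩ := h.exists_finite_net (ENNReal.ofReal_pos.2 hε3)
  refine ⟨t → ℤ, fun a μ => ⌊μ.1.1 a / (ε / 3)⌋, ?_, ?_⟩
  · refine (Set.Finite.pi fun _ : t => Set.finite_Icc ⌊-M / (ε / 3)⌋ ⌊M / (ε / 3)⌋).subset ?_
    rintro _ ⟨a, ⟨-, ha⟩, rfl⟩ μ -
    have := abs_le.1 ((μ.1.abs_apply_le a).trans ha)
    constructor <;> apply Int.floor_le_floor <;> gcongr
    · exact this.1
    · exact this.2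
  · rintro a ⟨ha, -⟩ b ⟨hb, -⟩ hab
    rw [dist_eq_norm]
    refine norm_le_of_forall_state fun ν => ?_
    obtain ⟨μ, hμ, hνμ⟩ := ht ν
    have h1 := abs_sub_le_of_rho_le hε3.le hνμ.le ha
    have h2 := abs_sub_le_of_rho_le hε3.le hνμ.le hb
    have h3 := Int.abs_sub_lt_one_of_floor_eq_floor (congrFun hab ⟨μ, hμ⟩)
    rw [← sub_div, abs_div, abs_of_pos hε3, div_lt_one hε3] at h3
    rw [map_sub]
    simp only [abs_le, abs_lt] at *
    constructor <;> linarith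

/-- The sufficient half of Rieffel's criterion. Every element is a multiple of one in the Lip-ball,
so `ρ_L`-convergence implies weak-* convergence. Conversely, subtracting a scalar moves the Lip-ball
into a totally bounded set without changing differences of states, so closeness at finitely many
elements bounds `ρ_L`. -/
theorem of_totallyBounded (h0 : ∀ a : A, L a = 0 ↔ ∃ r : ℝ, a = r • A.unit)
    {R : ℝ} (hR : ∀ a, L a ≤ 1 → ∃ s : ℝ, ‖a - s • A.unit‖ ≤ R)
    (htb : ∀ M : ℝ, TotallyBounded {a : A | L a ≤ 1 ∧ ‖a‖ ≤ M}) : IsLipNorm L := by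
  refine ⟨h0, le_antisymm ?_ ?_⟩
  · refine le_of_nhds_le_nhds fun μ => ?_
    have h1 : Tendsto id (@nhds _ (rhoPseudoEMetric L).toUniformSpace.toTopologicalSpace μ)
        (𝓝 μ) := by
      rw [tendsto_state_iff]
      intro a
      rw [Metric.tendsto_nhds]
      intro ε hε
      have hc : 0 < ε / (L a + 1) / 2 := by
        have := apply_nonneg L a
        positivity
      filter_upwards [@Metric.eball_mem_nhds _ (rhoPseudoEMetric L) μ _ (ENNReal.ofReal_pos.2 hc)]
        with ν hν
      have hν' : rho L ν μ ≤ _ := le_of_lt hν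
      have hL : 0 < L a + 1 := by
        have := apply_nonneg L a
        positivity
      have h2 := abs_sub_le_of_rho_le hc.le hν' (a := (L a + 1)⁻¹ • a) (by
        rw [map_smul_eq_mul, Real.norm_eq_abs, abs_of_pos (inv_pos.2 hL), inv_mul_le_one₀ hL]
        linarith)
      rw [map_smul, map_smul, smul_eq_mul, smul_eq_mul, ← mul_sub, abs_mul,
        abs_of_pos (inv_pos.2 hL), inv_mul_le_iff₀ hL] at h2
      rw [Real.dist_eq]
      refine h2.trans_lt ?_
      field_simp
      linarith
    exact h1
  · refine le_of_nhds_le_nhds fun μ => ?_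
    have h1 : Tendsto id (𝓝 μ) (@nhds _ (rhoPseudoEMetric L).toUniformSpace.toTopologicalSpace μ) := by
      refine (@EMetric.tendsto_nhds _ _ (rhoPseudoEMetric L) _ _ _).2 fun ε hε => ?_
      obtain ⟨δ, hδ, hδε⟩ := ENNReal.lt_iff_exists_nnreal_btwn.1 hε
      have hδ0 : 0 < (δ : ℝ) := by exact_mod_cast hδ
      obtain ⟨t, ht, hts⟩ := Metric.totallyBounded_iff.1 (htb R) (δ / 3) (by positivity)
      have h2 : ∀ᶠ ν in 𝓝 μ, ∀ b ∈ t, |ν.1 b - μ.1 b| < δ / 3 := by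
        rw [Filter.eventually_all_finite ht]
        intro b _
        exact Metric.tendsto_nhds.1 (tendsto_state_iff.1 (tendsto_id (x := 𝓝 μ)) b) _
          (by positivity)
      filter_upwards [h2] with ν hν
      refine lt_of_le_of_lt (rho_le (r := δ) fun a ha => ?_) (by simpa using hδε)
      obtain ⟨s, hs⟩ := hR a ha
      have hs1 : L (a - s • A.unit) ≤ 1 := by
        have := map_sub_le_add L a (s • A.unit)
        rw [(h0 (s • A.unit)).2 ⟨s, rfl⟩] at this
        linarith
      have hmem := hts ⟨hs1, hs⟩
      simp only [Set.mem_iUnion] at hmem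
      obtain ⟨b, hb, hab⟩ := hmem
      rw [Metric.mem_ball, dist_eq_norm] at hab
      have h3 := (ν.abs_apply_le _).trans hab.le
      have h4 := (μ.abs_apply_le _).trans hab.le
      have h5 := hν b hb
      simp only [map_sub, map_smul, ν.2.1, μ.2.1] at h3 h4
      simp only [id, abs_le, abs_lt] at *
      constructor <;> linarith
    exact h1

end IsLipNorm

/-! ### Correspondences and their effect on states -/

/-- A correspondence of distortion `r` between `(A, L_A)` and `(B, L_B)`: a symmetric convex
relation between the two Lip-balls that is total in both directions on the open Lip-balls,
invariant under simultaneous translation by the order units, and that preserves the order up to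
`r`. -/
structure IsCorr (LA : Seminorm ℝ A) (LB : Seminorm ℝ B) (U : Set (A × B)) (r : ℝ) : Prop where
  convex : Convex ℝ U
  neg_mem : ∀ a b, (a, b) ∈ U → (-a, -b) ∈ U
  add_unit : ∀ a b, (a, b) ∈ U → ∀ s : ℝ, (a + s • A.unit, b + s • B.unit) ∈ U
  lip_fst : ∀ a b, (a, b) ∈ U → LA a ≤ 1
  lip_snd : ∀ a b, (a, b) ∈ U → LB b ≤ 1
  exists_snd : ∀ a, LA a < 1 → ∃ b, (a, b) ∈ U ∧ LB b < 1
  exists_fst : ∀ b, LB b < 1 → ∃ a, (a, b) ∈ U ∧ LA a < 1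
  nonneg_snd : ∀ a b, (a, b) ∈ U → 0 ≤ a → 0 ≤ b + r • B.unit
  nonneg_fst : ∀ a b, (a, b) ∈ U → 0 ≤ b → 0 ≤ a + r • A.unit

namespace IsCorr

variable {LA : Seminorm ℝ A} {LB : Seminorm ℝ B} {LC : Seminorm ℝ C}
  {U : Set (A × B)} {V : Set (B × C)} {r s : ℝ}

theorem swap (h : IsCorr LA LB U r) : IsCorr LB LA (Prod.swap ⁻¹' U) r where
  convex := h.convex.linear_preimage (LinearEquiv.prodComm ℝ B A).toLinearMap
  neg_mem b a := h.neg_mem a b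
  add_unit b a := h.add_unit a b
  lip_fst b a := h.lip_snd a b
  lip_snd b a := h.lip_fst a b
  exists_snd := h.exists_fst
  exists_fst := h.exists_snd
  nonneg_snd b a := h.nonneg_fst a b
  nonneg_fst b a := h.nonneg_snd a b

theorem zero_mem (h : IsCorr LA LB U r) : (0 : A × B) ∈ U := by
  obtain ⟨b, hb, -⟩ := h.exists_snd 0 (by simp)
  have := h.convex hb (h.neg_mem _ _ hb) (a := 1 / 2) (b := 1 / 2) (by norm_num) (by norm_num)
    (by norm_num)
  have h0 : ((0 : A), (0 : B)) ∈ U := by simpa using this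
  exact h0

theorem nonneg (h : IsCorr LA LB U r) : 0 ≤ r := by
  have := h.nonneg_snd 0 0 h.zero_mem le_rfl
  exact nonneg_of_smul_unit_nonneg (by simpa using this)

theorem smul_mem (h : IsCorr LA LB U r) {a : A} {b : B} (hab : (a, b) ∈ U) {t : ℝ} (h0 : 0 ≤ t)
    (h1 : t ≤ 1) : (t • a, t • b) ∈ U :=
  h.convex.smul_mem_of_zero_mem h.zero_mem hab ⟨h0, h1⟩

theorem balanced (h : IsCorr LA LB U r) : Balanced ℝ U := by
  rintro c hc _ ⟨⟨a, b⟩, hp, rfl⟩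
  rw [Real.norm_eq_abs] at hc
  rcases le_total 0 c with h0 | h0
  · rw [abs_of_nonneg h0] at hc
    exact h.smul_mem hp h0 hc
  · rw [abs_of_nonpos h0] at hc
    have := h.smul_mem (h.neg_mem _ _ hp) (neg_nonneg.2 h0) hc
    simpa using this

theorem half_sub_mem (h : IsCorr LA LB U r) {a a' : A} {b b' : B} (hab : (a, b) ∈ U)
    (hab' : (a', b') ∈ U) : ((1 / 2 : ℝ) • (a - a'), (1 / 2 : ℝ) • (b - b')) ∈ U := by
  have := h.convex hab (h.neg_mem _ _ hab') (a := 1 / 2) (b := 1 / 2) (by norm_num) (by norm_num)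
    (by norm_num)
  simpa [smul_sub, sub_eq_add_neg] using this

theorem nonneg_snd_add (h : IsCorr LA LB U r) {a : A} {b : B} (hab : (a, b) ∈ U) {t : ℝ}
    (ha : 0 ≤ a + t • A.unit) : 0 ≤ b + (t + r) • B.unit := by
  have := h.nonneg_snd _ _ (h.add_unit a b hab t) ha
  rwa [add_assoc, ← add_smul] at this

theorem norm_snd_le (h : IsCorr LA LB U r) {a : A} {b : B} (hab : (a, b) ∈ U) :
    ‖b‖ ≤ ‖a‖ + r := by
  obtain ⟨h1, h2⟩ := norm_le_iff.1 (le_refl ‖a‖)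
  exact norm_le_iff.2 ⟨h.nonneg_snd_add hab h1, h.nonneg_snd_add (h.neg_mem _ _ hab) h2⟩

/-- A partner is again in the open Lip-ball, so it can be passed to the next correspondence;
translation by units lets the order errors add. -/
theorem comp (h : IsCorr LA LB U r) (k : IsCorr LB LC V s) :
    IsCorr LA LC {p | ∃ b, (p.1, b) ∈ U ∧ (b, p.2) ∈ V} (r + s) where
  convex := by
    rintro ⟨a, c⟩ ⟨b, h1, h2⟩ ⟨a', c'⟩ ⟨b', h1', h2'⟩ x y hx hy hxy
    exact ⟨x • b + y • b', h.convex h1 h1' hx hy hxy, k.convex h2 h2' hx hy hxy⟩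
  neg_mem := by
    rintro a c ⟨b, h1, h2⟩
    exact ⟨-b, h.neg_mem _ _ h1, k.neg_mem _ _ h2⟩
  add_unit := by
    rintro a c ⟨b, h1, h2⟩ t
    exact ⟨b + t • B.unit, h.add_unit _ _ h1 t, k.add_unit _ _ h2 t⟩
  lip_fst := by
    rintro a c ⟨b, h1, h2⟩
    exact h.lip_fst _ _ h1
  lip_snd := by
    rintro a c ⟨b, h1, h2⟩
    exact k.lip_snd _ _ h2
  exists_snd := fun a ha => by
    obtain ⟨b, hab, hb⟩ := h.exists_snd a ha
    obtain ⟨c, hbc, hc⟩ := k.exists_snd b hb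
    exact ⟨c, ⟨b, hab, hbc⟩, hc⟩
  exists_fst := fun c hc => by
    obtain ⟨b, hbc, hb⟩ := k.exists_fst c hc
    obtain ⟨a, hab, ha⟩ := h.exists_fst b hb
    exact ⟨a, ⟨b, hab, hbc⟩, ha⟩
  nonneg_snd := by
    rintro a c ⟨b, h1, h2⟩ ha
    exact k.nonneg_snd_add h2 (h.nonneg_snd _ _ h1 ha)
  nonneg_fst := by
    rintro a c ⟨b, h1, h2⟩ hc
    rw [add_comm r s]
    exact h.swap.nonneg_snd_add h1 (k.nonneg_fst _ _ h2 hc)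

/-- Take the cone generated by the positive elements of `B` and all `-b + (μ(a) + r) e` with `(a, b)
∈ U`. A state nonnegative on it satisfies `ν(b) ≤ μ(a) + r`, and the symmetry of `U` gives the other
inequality. The cone contains no negative multiple of `e`: such a relation would bound some `b`
below by more than `μ(a) + r`, hence its partner `a` below by more than `μ(a)`, contradicting the
positivity of `μ`. -/
theorem exists_state (h : IsCorr LA LB U r) (μ : A.StateSpace) :
    ∃ ν : B.StateSpace, ∀ a b, (a, b) ∈ U → |μ.1 a - ν.1 b| ≤ r := by
  let S : PointedCone ℝ B :=
    { carrier := {x | ∃ t : ℝ, 0 ≤ t ∧ ∃ p ∈ U,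
        0 ≤ x + t • p.2 - (t * (μ.1 p.1 + r)) • B.unit}
      zero_mem' := ⟨0, le_rfl, 0, h.zero_mem, by simp⟩
      add_mem' := by
        rintro x y ⟨t, ht, p, hp, hx⟩ ⟨t', ht', p', hp', hy⟩
        -- Convexity of `U` merges the two generators after division by the total weight, which must
        -- therefore be nonzero.
        rcases (add_nonneg ht ht').eq_or_lt with h0 | h0
        · obtain rfl : t = 0 := by linarith
          obtain rfl : t' = 0 := by linarith
          refine ⟨0, le_rfl, 0, h.zero_mem, ?_⟩
          have := add_nonneg hx hy
          simpa using this
        · refine ⟨t + t', h0.le, (t / (t + t')) • p + (t' / (t + t')) • p',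
            h.convex hp hp' (by positivity) (by positivity) (by field_simp), ?_⟩
          have e1 : (t + t') • ((t / (t + t')) • p + (t' / (t + t')) • p') = t • p + t' • p' := by
            rw [smul_add, smul_smul, smul_smul, mul_div_cancel₀ _ h0.ne', mul_div_cancel₀ _ h0.ne']
          have e2 : (t + t') • ((t / (t + t')) • p + (t' / (t + t')) • p').2 =
              t • p.2 + t' • p'.2 := congrArg Prod.snd e1
          have e3 : (t + t') * μ.1 ((t / (t + t')) • p + (t' / (t + t')) • p').1 =
              t * μ.1 p.1 + t' * μ.1 p'.1 := by
            have := congrArg (fun q => μ.1 q.1) e1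
            simpa [mul_add] using this
          have := add_nonneg hx hy
          rw [e2, mul_add, e3]
          refine this.trans_eq ?_
          module
      smul_mem' := by
        rintro ⟨c, hc⟩ x ⟨t, ht, p, hp, hx⟩
        refine ⟨c * t, mul_nonneg hc ht, p, hp, ?_⟩
        have := smul_nonneg hc hx
        refine this.trans_eq ?_
        change c • _ = c • x + _ - _
        module }
  obtain ⟨ν, hν⟩ := exists_state_nonneg S
    (fun x hx => ⟨0, le_rfl, 0, h.zero_mem, by simpa using hx⟩) (by
    rintro x ⟨t, ht, ⟨a, b⟩, hp, hx⟩
    rcases ht.eq_or_lt with rfl | ht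
    · exact nonneg_of_smul_unit_nonneg (by simpa using hx)
    · have h1 : 0 ≤ b + (x / t - (μ.1 a + r)) • B.unit := by
        have := smul_nonneg (inv_nonneg.2 ht.le) hx
        refine this.trans_eq ?_
        match_scalars <;> field_simp
      have h2 := μ.nonneg (h.swap.nonneg_snd_add hp h1)
      rw [map_add, map_smul, μ.2.1, smul_eq_mul, mul_one] at h2
      have h3 : 0 ≤ x / t := by linarith
      by_contra hx0
      exact absurd (div_neg_of_neg_of_pos (not_le.1 hx0) ht) (not_lt.2 h3))
  have key : ∀ a b, (a, b) ∈ U → ν.1 b ≤ μ.1 a + r := fun a b hab => by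
    have := hν (-b + (μ.1 a + r) • B.unit) ⟨1, zero_le_one, (a, b), hab, by simp⟩
    rw [map_add, map_neg, map_smul, ν.2.1, smul_eq_mul, mul_one] at this
    linarith
  refine ⟨ν, fun a b hab => ?_⟩
  have h1 := key a b hab
  have h2 := key _ _ (h.neg_mem a b hab)
  rw [map_neg, map_neg] at h2
  rw [abs_le]
  constructor <;> linarith

end IsCorr

end OrderUnitSpace

theorem Balanced.absorbent {E : Type*} [AddCommGroup E] [Module ℝ E] {s : Set E}
    (hs : Balanced ℝ s) (h : ∀ x, ∃ t : ℝ, 0 < t ∧ t • x ∈ s) : Absorbent ℝ s := by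
  rw [absorbent_iff_forall_absorbs_singleton]
  intro x
  obtain ⟨t, ht, hx⟩ := h x
  rw [absorbs_iff_norm]
  refine ⟨t⁻¹, fun c hc => ?_⟩
  have hc0 : 0 < ‖c‖ := (inv_pos.2 ht).trans_le hc
  have hc1 : c ≠ 0 := norm_pos_iff.1 hc0
  rw [Set.singleton_subset_iff]
  refine ⟨(c⁻¹ * t⁻¹) • t • x, hs.smul_mem ?_ hx, ?_⟩
  · rw [norm_mul, norm_inv, norm_inv, Real.norm_of_nonneg ht.le, inv_mul_le_iff₀ hc0, mul_one]
    exact hc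
  · simp only [smul_smul]
    rw [mul_assoc, inv_mul_cancel₀ ht.ne', mul_one, mul_inv_cancel₀ hc1, one_smul]

/-! ### Translation between correspondences and Lip-norms on the direct sum -/

namespace OrderUnitSpace

variable {A B C : OrderUnitSpace.{u}}

namespace Induces

variable {π : C →ₗ[ℝ] A} {L : Seminorm ℝ C} {LA : Seminorm ℝ A}

theorem bddBelow_image (π : C →ₗ[ℝ] A) (L : Seminorm ℝ C) (a : A) :
    BddBelow (L '' {c | π c = a}) :=
  ⟨0, by rintro _ ⟨c, -, rfl⟩; exact apply_nonneg L c⟩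

theorem of_ball (h1 : ∀ c, L c ≤ 1 → LA (π c) ≤ 1) (h2 : ∀ a, LA a < 1 → ∃ c, π c = a ∧ L c ≤ 1) :
    Induces π L LA := by
  have key : ∀ a t, LA a < t → ∃ c, π c = a ∧ L c ≤ t := fun a t hat => by
    have ht : 0 < t := (apply_nonneg LA a).trans_lt hat
    obtain ⟨c, hc, hLc⟩ := h2 (t⁻¹ • a) (by
      rw [map_smul_eq_mul, Real.norm_eq_abs, abs_of_pos (inv_pos.2 ht), inv_mul_lt_one₀ ht]
      exact hat)
    refine ⟨t • c, by rw [map_smul, hc, smul_smul, mul_inv_cancel₀ ht.ne', one_smul], ?_⟩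
    rw [map_smul_eq_mul, Real.norm_eq_abs, abs_of_pos ht]
    exact mul_le_of_le_one_right ht.le hLc
  intro a
  apply le_antisymm
  · obtain ⟨c, hc, -⟩ := key a (LA a + 1) (by linarith)
    refine le_csInf ⟨_, c, hc, rfl⟩ ?_
    rintro _ ⟨c, rfl, rfl⟩
    refine le_of_forall_gt_imp_ge_of_dense fun t hct => ?_
    have ht : 0 < t := (apply_nonneg L c).trans_lt hct
    have := h1 (t⁻¹ • c) (by
      rw [map_smul_eq_mul, Real.norm_eq_abs, abs_of_pos (inv_pos.2 ht), inv_mul_le_one₀ ht]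
      exact hct.le)
    rwa [map_smul, map_smul_eq_mul, Real.norm_eq_abs, abs_of_pos (inv_pos.2 ht),
      inv_mul_le_one₀ ht] at this
  · refine le_of_forall_gt_imp_ge_of_dense fun t hat => ?_
    obtain ⟨c, hc, hLc⟩ := key a t hat
    exact (csInf_le (bddBelow_image π L a) (Set.mem_image_of_mem _ hc)).trans hLc

theorem le (h : Induces π L LA) (c : C) : LA (π c) ≤ L c := by
  rw [h]
  exact csInf_le (bddBelow_image π L _) ⟨c, rfl, rfl⟩

theorem exists_lt (h : Induces π L LA) (hπ : Function.Surjective π) {a : A} {t : ℝ}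
    (ha : LA a < t) : ∃ c, π c = a ∧ L c < t := by
  rw [h] at ha
  obtain ⟨c, hc⟩ := hπ a
  have hne : (L '' {c | π c = a}).Nonempty := ⟨_, c, hc, rfl⟩
  obtain ⟨_, ⟨c, hc, rfl⟩, hlt⟩ := exists_lt_of_csInf_lt hne ha
  exact ⟨c, hc, hlt⟩

end Induces

namespace IsCorr

variable {LA : Seminorm ℝ A} {LB : Seminorm ℝ B} {U : Set (A × B)} {r : ℝ}

/-- A point of gauge at most `1` is, for every `t > 1`, of the form `s • p` with `p ∈ U` and `0 < s
< t`. Each condition is closed under letting `t` tend to `1`; for the order conditions this is the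
Archimedean axiom, so the distortion does not grow. -/
theorem gauge (h : IsCorr LA LB U r) (habs : Absorbent ℝ U) :
    IsCorr LA LB {p | gauge U p ≤ 1} r := by
  have hexp : ∀ a b, _root_.gauge U (a, b) ≤ 1 → ∀ t : ℝ, 1 < t →
      ∃ s a' b', 0 < s ∧ s < t ∧ (a', b') ∈ U ∧ a = s • a' ∧ b = s • b' := fun a b hab t ht => by
    obtain ⟨s, hs, hst, ⟨a', b'⟩, hab', hs'⟩ := exists_lt_of_gauge_lt habs (hab.trans_lt ht)
    exact ⟨s, a', b', hs, hst, hab', (congrArg Prod.fst hs').symm, (congrArg Prod.snd hs').symm⟩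
  have hsub : U ⊆ {p | _root_.gauge U p ≤ 1} := self_subset_setOfPred_gauge_le_one
  have hr := h.nonneg
  -- Scaling by less than `1 + ε / (r + 1)` enlarges the error `r` by at most `ε`.
  have hlt : ∀ ε : ℝ, 0 < ε → 1 < 1 + ε / (r + 1) := fun ε hε => by
    have : 0 < ε / (r + 1) := by positivity
    linarith
  have hle : ∀ {D : OrderUnitSpace.{u}} {b : D} {s ε : ℝ}, 0 < s → s < 1 + ε / (r + 1) → 0 < ε →
      0 ≤ b + r • D.unit → 0 ≤ s • b + r • D.unit + ε • D.unit := fun {D b s ε} hs hst hε hb => by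
    have h1 := smul_nonneg hs.le hb
    rw [smul_add, smul_smul] at h1
    rw [add_assoc, ← add_smul]
    refine nonneg_mono h1 ?_
    have h2 : s * r ≤ (1 + ε / (r + 1)) * r := by gcongr
    have h3 : ε / (r + 1) * r ≤ ε := by
      rw [div_mul_eq_mul_div, div_le_iff₀ (by positivity)]
      nlinarith
    linarith
  have hpos : ∀ {D : OrderUnitSpace.{u}} {b : D} {s : ℝ}, 0 < s → 0 ≤ s • b → 0 ≤ b :=
    fun {D b s} hs hb => by
      have := smul_nonneg (inv_nonneg.2 hs.le) hb
      rwa [smul_smul, inv_mul_cancel₀ hs.ne', one_smul] at this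
  refine ⟨h.convex.setOfPred_gauge_le h.zero_mem habs 1, fun a b hab => ?_, fun a b hab s => ?_,
    fun a b hab => ?_, fun a b hab => ?_, fun a ha => ?_, fun b hb => ?_, fun a b hab ha => ?_,
    fun a b hab hb => ?_⟩
  · have : _root_.gauge U (-(a, b)) = _root_.gauge U (a, b) :=
      gauge_neg (fun p hp => h.neg_mem p.1 p.2 hp) _
    exact this.le.trans hab
  · have h0 : ∀ s : ℝ, _root_.gauge U (s • (A.unit, B.unit)) ≤ 1 := fun s =>
      gauge_le_one_of_mem (by simpa using h.add_unit 0 0 h.zero_mem s)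
    -- The whole line through the unit lies in `U`, so homogeneity forces its gauge to vanish.
    have h1 : _root_.gauge U (s • (A.unit, B.unit)) ≤ 0 := by
      refine le_of_forall_pos_le_add fun ε hε => ?_
      have h2 := h0 (ε⁻¹ * s)
      rw [mul_smul, gauge_smul_of_nonneg (inv_nonneg.2 hε.le), smul_eq_mul,
        inv_mul_le_one₀ hε] at h2
      simpa using h2
    refine (gauge_add_le h.convex habs (a, b) (s • (A.unit, B.unit))).trans ?_
    have hab : _root_.gauge U (a, b) ≤ 1 := hab
    linarith
  · refine le_of_forall_gt_imp_ge_of_dense fun t ht => ?_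
    obtain ⟨s, a', b', hs, hst, hU, rfl, rfl⟩ := hexp a b hab t ht
    rw [map_smul_eq_mul, Real.norm_eq_abs, abs_of_pos hs]
    exact (mul_le_of_le_one_right hs.le (h.lip_fst _ _ hU)).trans hst.le
  · refine le_of_forall_gt_imp_ge_of_dense fun t ht => ?_
    obtain ⟨s, a', b', hs, hst, hU, rfl, rfl⟩ := hexp a b hab t ht
    rw [map_smul_eq_mul, Real.norm_eq_abs, abs_of_pos hs]
    exact (mul_le_of_le_one_right hs.le (h.lip_snd _ _ hU)).trans hst.le
  · obtain ⟨b, hb, hb'⟩ := h.exists_snd a ha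
    exact ⟨b, hsub hb, hb'⟩
  · obtain ⟨a, ha, ha'⟩ := h.exists_fst b hb
    exact ⟨a, hsub ha, ha'⟩
  · refine nonneg_of_forall_pos fun ε hε => ?_
    obtain ⟨s, a', b', hs, hst, hU, rfl, rfl⟩ := hexp a b hab _ (hlt ε hε)
    exact hle hs hst hε (h.nonneg_snd _ _ hU (hpos hs ha))
  · refine nonneg_of_forall_pos fun ε hε => ?_
    obtain ⟨s, a', b', hs, hst, hU, rfl, rfl⟩ := hexp a b hab _ (hlt ε hε)
    exact hle hs hst hε (h.nonneg_fst _ _ hU (hpos hs hb))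

/-- The points of `L_A ≤ 1`, `L_B ≤ 1` at distance at most `ε` from `U` in the second
coordinate. -/
def _root_.OrderUnitSpace.fatten (LA : Seminorm ℝ A) (LB : Seminorm ℝ B) (U : Set (A × B))
    (ε : ℝ) : Set (A × B) :=
  {p | LA p.1 ≤ 1 ∧ LB p.2 ≤ 1 ∧ ∃ b, (p.1, b) ∈ U ∧ ‖p.2 - b‖ ≤ ε}

theorem subset_fatten (h : IsCorr LA LB U r) {ε : ℝ} (hε : 0 ≤ ε) : U ⊆ fatten LA LB U ε :=
  fun p hp => ⟨h.lip_fst _ _ hp, h.lip_snd _ _ hp, p.2, hp, by simpa using hε⟩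

theorem fatten (h : IsCorr LA LB U r) (hA : IsLipNorm LA) (hB : IsLipNorm LB) {ε : ℝ}
    (hε : 0 ≤ ε) : IsCorr LA LB (fatten LA LB U ε) (r + ε) where
  convex := by
    rintro ⟨a, c⟩ ⟨h1, h2, b, hab, hcb⟩ ⟨a', c'⟩ ⟨h1', h2', b', hab', hcb'⟩ x y hx hy hxy
    have conv : ∀ {D : OrderUnitSpace.{u}} (L : Seminorm ℝ D) {R : ℝ} {u v : D}, L u ≤ R →
        L v ≤ R → L (x • u + y • v) ≤ R := fun L R u v hu hv => by
      refine (map_add_le_add L _ _).trans ?_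
      rw [map_smul_eq_mul, map_smul_eq_mul, Real.norm_eq_abs, Real.norm_eq_abs, abs_of_nonneg hx,
        abs_of_nonneg hy]
      calc x * L u + y * L v ≤ x * R + y * R := by gcongr
        _ = R := by rw [← add_mul, hxy, one_mul]
    refine ⟨conv LA h1 h1', conv LB h2 h2', x • b + y • b', h.convex hab hab' hx hy hxy, ?_⟩
    have := conv (normSeminorm ℝ B) hcb hcb'
    have e : x • c + y • c' - (x • b + y • b') = x • (c - b) + y • (c' - b') := by module
    change ‖x • c + y • c' - (x • b + y • b')‖ ≤ ε
    rw [e]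
    exact this
  neg_mem := by
    rintro a c ⟨h1, h2, b, hab, hcb⟩
    refine ⟨by simpa using h1, by simpa using h2, -b, h.neg_mem _ _ hab, ?_⟩
    change ‖-c - -b‖ ≤ ε
    rwa [← neg_sub', norm_neg]
  add_unit := by
    rintro a c ⟨h1, h2, b, hab, hcb⟩ s
    refine ⟨(map_add_le_add LA _ _).trans ?_, (map_add_le_add LB _ _).trans ?_,
      b + s • B.unit, h.add_unit _ _ hab s, by simpa using hcb⟩
    · rw [hA.lip_smul_unit, add_zero]; exact h1
    · rw [hB.lip_smul_unit, add_zero]; exact h2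
  lip_fst _ _ hp := hp.1
  lip_snd _ _ hp := hp.2.1
  exists_snd a ha := by
    obtain ⟨b, hb, hb'⟩ := h.exists_snd a ha
    exact ⟨b, h.subset_fatten hε hb, hb'⟩
  exists_fst b hb := by
    obtain ⟨a, ha, ha'⟩ := h.exists_fst b hb
    exact ⟨a, h.subset_fatten hε ha, ha'⟩
  nonneg_snd := by
    rintro a c ⟨h1, h2, b, hab, hcb⟩ ha
    have := add_nonneg (h.nonneg_snd _ _ hab ha) (norm_le_iff.1 hcb).1
    refine this.trans_eq ?_
    change b + r • B.unit + (c - b + ε • B.unit) = c + _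
    module
  nonneg_fst := by
    rintro a c ⟨h1, h2, b, hab, hcb⟩ hc
    rw [add_comm r]
    refine h.swap.nonneg_snd_add hab ?_
    have := add_nonneg hc (norm_le_iff.1 hcb).2
    refine this.trans_eq ?_
    change c + (-(c - b) + ε • B.unit) = b + _
    module

/-- A correspondence may lie in a proper subspace, such as a graph, where its gauge is useless.
After fattening, scale `(a, c)` until `a` has a partner `b`, then shrink further until the second
coordinate is within `ε` of that of the shrunken pair. -/
theorem absorbent_fatten (h : IsCorr LA LB U r) {ε : ℝ} (hε : 0 < ε) :
    Absorbent ℝ (OrderUnitSpace.fatten LA LB U ε) := by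
  have hbal : Balanced ℝ (OrderUnitSpace.fatten LA LB U ε) := by
    rintro t ht _ ⟨⟨a, c⟩, ⟨h1, h2, b, hab, hcb⟩, rfl⟩
    have conv : ∀ {D : OrderUnitSpace.{u}} (L : Seminorm ℝ D) {R : ℝ} {u : D}, L u ≤ R →
        L (t • u) ≤ R := fun L R u hu => by
      rw [map_smul_eq_mul]
      exact (mul_le_of_le_one_left (apply_nonneg _ _) ht).trans hu
    refine ⟨conv LA h1, conv LB h2, t • b, h.balanced.smul_mem ht hab, ?_⟩
    change ‖t • c - t • b‖ ≤ ε
    rw [← smul_sub]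
    exact conv (normSeminorm ℝ B) hcb
  refine hbal.absorbent ?_
  rintro ⟨a, c⟩
  have hA0 := apply_nonneg LA a
  have hB0 := apply_nonneg LB c
  set t := LA a + LB c + 1 with ht
  have htp : 0 < t := by positivity
  obtain ⟨b, hb, -⟩ := h.exists_snd (t⁻¹ • a) (by
    rw [map_smul_eq_mul, Real.norm_eq_abs, abs_of_pos (inv_pos.2 htp), inv_mul_lt_one₀ htp]
    linarith)
  -- Dividing by `N` brings the distance below `ε`; the summand `1` keeps `N ≥ 1`, so the Lip bounds
  -- and membership in `U` survive.
  set N := ‖t⁻¹ • c - b‖ / ε + 1 with hN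
  have hNp : 0 < N := by positivity
  have hN1 : 1 ≤ N := by rw [hN]; linarith [show 0 ≤ ‖t⁻¹ • c - b‖ / ε by positivity]
  have hNi : N⁻¹ ≤ 1 := inv_le_one_of_one_le₀ hN1
  have hmem : (N⁻¹ • t⁻¹ • a, N⁻¹ • t⁻¹ • c) ∈ OrderUnitSpace.fatten LA LB U ε := by
    have h1 : LB (t⁻¹ • c) ≤ 1 := by
      rw [map_smul_eq_mul, Real.norm_eq_abs, abs_of_pos (inv_pos.2 htp), inv_mul_le_one₀ htp]
      linarith
    have hm := h.smul_mem hb (inv_nonneg.2 hNp.le) hNi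
    refine ⟨h.lip_fst _ _ hm, ?_, _, hm, ?_⟩
    · change LB (N⁻¹ • t⁻¹ • c) ≤ 1
      rw [map_smul_eq_mul, Real.norm_eq_abs, abs_of_pos (inv_pos.2 hNp)]
      exact mul_le_one₀ hNi (apply_nonneg _ _) h1
    · change ‖N⁻¹ • t⁻¹ • c - N⁻¹ • b‖ ≤ ε
      rw [← smul_sub, norm_smul, Real.norm_eq_abs, abs_of_pos (inv_pos.2 hNp),
        inv_mul_le_iff₀ hNp, hN, add_mul, div_mul_cancel₀ _ hε.ne']
      linarith
  exact ⟨N⁻¹ * t⁻¹, by positivity, by rw [mul_smul]; exact hmem⟩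

end IsCorr

/-- The pair `(a, b)` as an element of `A ⊕ B`. -/
def pair (a : A) (b : B) : A.prod B := (a, b)

theorem pair_smul (r : ℝ) (a : A) (b : B) : pair (r • a) (r • b) = r • pair a b := rfl

theorem pair_neg (a : A) (b : B) : pair (-a) (-b) = -pair a b := rfl

theorem pair_sub (a a' : A) (b b' : B) : pair (a - a') (b - b') = pair a b - pair a' b' := rfl

theorem pair_unit : pair A.unit B.unit = (A.prod B).unit := rfl

theorem norm_pair_le {a : A} {b : B} {M : ℝ} (ha : ‖a‖ ≤ M) (hb : ‖b‖ ≤ M) : ‖pair a b‖ ≤ M := by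
  obtain ⟨h1, h2⟩ := norm_le_iff.1 ha
  obtain ⟨h3, h4⟩ := norm_le_iff.1 hb
  exact norm_le_iff.2 ⟨⟨h1, h3⟩, ⟨h2, h4⟩⟩

theorem norm_fst_le_norm_pair (a : A) (b : B) : ‖a‖ ≤ ‖pair a b‖ := by
  obtain ⟨h1, h2⟩ := norm_le_iff.1 (le_refl ‖pair a b‖)
  exact norm_le_iff.2 ⟨h1.1, h2.1⟩

theorem norm_snd_le_norm_pair (a : A) (b : B) : ‖b‖ ≤ ‖pair a b‖ := by
  obtain ⟨h1, h2⟩ := norm_le_iff.1 (le_refl ‖pair a b‖)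
  exact norm_le_iff.2 ⟨h1.2, h2.2⟩

/-- The state of `C` induced by a state of `A` and a positive unital map `C → A`. -/
noncomputable def pullbackState {C : OrderUnitSpace.{u}} (π : C →ₗ[ℝ] A)
    (hπ : ∀ c, 0 ≤ c → 0 ≤ π c) (h1 : π C.unit = A.unit) (μ : A.StateSpace) : C.StateSpace :=
  stateOfPositive ((WeakDual.toStrongDual μ.1).toLinearMap ∘ₗ π) (fun c hc => μ.nonneg (hπ c hc))
    (by
      have := μ.2.1
      simpa [h1] using this)

/-- The state of `A ⊕ B` induced by a state of `A`. -/
noncomputable def stateFst (B : OrderUnitSpace.{u}) (μ : A.StateSpace) : (A.prod B).StateSpace :=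
  pullbackState (prodFst A B) (fun _ h => h.1) rfl μ

/-- The state of `A ⊕ B` induced by a state of `B`. -/
noncomputable def stateSnd (A : OrderUnitSpace.{u}) (ν : B.StateSpace) : (A.prod B).StateSpace :=
  pullbackState (prodSnd A B) (fun _ h => h.2) rfl ν

theorem stateFst_apply (μ : A.StateSpace) (a : A) (b : B) :
    (stateFst B μ).1 (pair a b) = μ.1 a := rfl

theorem stateSnd_apply (ν : B.StateSpace) (a : A) (b : B) :
    (stateSnd A ν).1 (pair a b) = ν.1 b := rfl

theorem stateFst_mem (μ : A.StateSpace) : stateFst B μ ∈ stateImage (prodFst A B) :=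
  ⟨μ, fun _ => rfl⟩

theorem stateSnd_mem (ν : B.StateSpace) : stateSnd A ν ∈ stateImage (prodSnd A B) :=
  ⟨ν, fun _ => rfl⟩

theorem state_ext {σ τ : A.StateSpace} (h : ∀ a, σ.1 a = τ.1 a) : σ = τ :=
  Subtype.ext (DFunLike.ext _ _ h)

theorem mem_stateImage_fst {σ : (A.prod B).StateSpace} (h : σ ∈ stateImage (prodFst A B)) :
    ∃ μ : A.StateSpace, σ = stateFst B μ := by
  obtain ⟨μ, hμ⟩ := h
  exact ⟨μ, state_ext hμ⟩

theorem mem_stateImage_snd {σ : (A.prod B).StateSpace} (h : σ ∈ stateImage (prodSnd A B)) :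
    ∃ ν : B.StateSpace, σ = stateSnd A ν := by
  obtain ⟨ν, hν⟩ := h
  exact ⟨ν, state_ext hν⟩

variable {LA : Seminorm ℝ A} {LB : Seminorm ℝ B} {L : Seminorm ℝ (A.prod B)} {r : ℝ}

namespace IsCorr

/-- Rieffel's criterion applies: the norm of `b` exceeds that of its partner by at most `r`, so the
ball is bounded modulo common scalars, and its bounded parts lie in products of totally bounded
sets. -/
theorem isLipNorm (h : IsCorr LA LB {p | L (pair p.1 p.2) ≤ 1} r) (hA : IsLipNorm LA)
    (hB : IsLipNorm LB) : IsLipNorm L := by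
  obtain ⟨R, hR0, hR⟩ := hA.exists_norm_sub_le
  have key : ∀ a b, L (pair a b) ≤ 1 →
      ∃ s : ℝ, ‖pair a b - s • (A.prod B).unit‖ ≤ R + r := fun a b hab => by
    obtain ⟨s, hs⟩ := hR a (h.lip_fst a b hab)
    refine ⟨s, ?_⟩
    rw [← pair_unit, ← pair_smul, ← pair_sub]
    have h1 := h.add_unit a b hab (-s)
    rw [neg_smul, neg_smul, ← sub_eq_add_neg, ← sub_eq_add_neg] at h1
    exact norm_pair_le (by linarith [h.nonneg]) ((h.norm_snd_le h1).trans (by linarith))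
  have hu : ∀ s : ℝ, L (pair (s • A.unit) (s • B.unit)) ≤ 1 := fun s => by
    simpa using h.add_unit 0 0 h.zero_mem s
  refine IsLipNorm.of_totallyBounded (R := R + r) (fun c => ?_) (fun c => key c.1 c.2) fun M => ?_
  · constructor
    · intro hc
      obtain ⟨a, b⟩ := c
      change L (pair a b) = 0 at hc
      have hscale : ∀ n : ℝ, L (pair (n • a) (n • b)) ≤ 1 := fun n => by
        rw [pair_smul, map_smul_eq_mul, hc, mul_zero]; exact zero_le_one
      have hLA : LA a = 0 := by
        refine le_antisymm (le_of_forall_pos_le_add fun ε hε => ?_) (apply_nonneg _ _)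
        have := h.lip_fst _ _ (hscale ε⁻¹)
        rw [map_smul_eq_mul, Real.norm_eq_abs, abs_of_pos (inv_pos.2 hε), inv_mul_le_one₀ hε]
          at this
        simpa using this
      obtain ⟨s, rfl⟩ := (hA.eq_zero_iff a).1 hLA
      refine ⟨s, ?_⟩
      have hb : b - s • B.unit = 0 := by
        rw [← norm_le_zero_iff]
        refine le_of_forall_pos_le_add fun ε hε => ?_
        have hr := h.nonneg
        -- All multiples of `(0, b - s e)` lie in the ball, and the partner of `0` has norm at most
        -- `r`; the multiple `(r + 1) / ε` leaves `‖b - s e‖ ≤ ε`.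
        have h1 := h.add_unit _ _ (hscale ((r + 1) / ε)) (-((r + 1) / ε * s))
        have h2 := h.norm_snd_le h1
        have e1 : ((r + 1) / ε) • s • A.unit + (-((r + 1) / ε * s)) • A.unit = 0 := by module
        have e2 : ((r + 1) / ε) • b + (-((r + 1) / ε * s)) • B.unit =
          ((r + 1) / ε) • (b - s • B.unit) := by module
        rw [e1, e2, norm_zero, norm_smul, Real.norm_of_nonneg (by positivity), zero_add,
          div_mul_eq_mul_div, div_le_iff₀ hε] at h2
        nlinarith [norm_nonneg (b - s • B.unit)]
      rw [sub_eq_zero] at hb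
      rw [hb]
      rfl
    · rintro ⟨s, rfl⟩
      refine le_antisymm (le_of_forall_pos_le_add fun ε hε => ?_) (apply_nonneg _ _)
      have := hu (ε⁻¹ * s)
      rw [pair_smul, pair_unit, mul_smul, map_smul_eq_mul, Real.norm_eq_abs,
        abs_of_pos (inv_pos.2 hε), inv_mul_le_one₀ hε] at this
      simpa using this
  · rw [totallyBounded_iff_exists_coloring]
    intro ε hε
    obtain ⟨ι, c, hc, hcs⟩ := totallyBounded_iff_exists_coloring.1 (hA.totallyBounded M) ε hε
    obtain ⟨κ, d, hd, hds⟩ := totallyBounded_iff_exists_coloring.1 (hB.totallyBounded M) ε hε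
    have hmem : ∀ x : A.prod B, L x ≤ 1 ∧ ‖x‖ ≤ M →
        x.1 ∈ {a : A | LA a ≤ 1 ∧ ‖a‖ ≤ M} ∧ x.2 ∈ {b : B | LB b ≤ 1 ∧ ‖b‖ ≤ M} := fun x hx =>
      ⟨⟨h.lip_fst x.1 x.2 hx.1, (norm_fst_le_norm_pair x.1 x.2).trans hx.2⟩,
        ⟨h.lip_snd x.1 x.2 hx.1, (norm_snd_le_norm_pair x.1 x.2).trans hx.2⟩⟩
    refine ⟨ι × κ, fun x => (c x.1, d x.2), (hc.prod hd).subset ?_, fun x hx y hy hxy => ?_⟩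
    · rintro _ ⟨x, hx, rfl⟩
      exact ⟨⟨_, (hmem x hx).1, rfl⟩, ⟨_, (hmem x hx).2, rfl⟩⟩
    · have h1 := hcs _ (hmem x hx).1 _ (hmem y hy).1 (congrArg Prod.fst hxy)
      have h2 := hds _ (hmem x hx).2 _ (hmem y hy).2 (congrArg Prod.snd hxy)
      rw [dist_eq_norm] at h1 h2 ⊢
      exact norm_pair_le h1 h2

theorem mem_lipNormsInducing (h : IsCorr LA LB {p | L (pair p.1 p.2) ≤ 1} r) (hA : IsLipNorm LA)
    (hB : IsLipNorm LB) : L ∈ lipNormsInducing LA LB := by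
  refine ⟨h.isLipNorm hA hB, .of_ball (fun c hc => h.lip_fst c.1 c.2 hc) fun a ha => ?_,
    .of_ball (fun c hc => h.lip_snd c.1 c.2 hc) fun b hb => ?_⟩
  · obtain ⟨b, hb, -⟩ := h.exists_snd a ha
    exact ⟨pair a b, rfl, hb⟩
  · obtain ⟨a, ha, -⟩ := h.exists_fst b hb
    exact ⟨pair a b, rfl, ha⟩

theorem hausdorffEDist_le (h : IsCorr LA LB {p | L (pair p.1 p.2) ≤ 1} r) :
    @Metric.hausdorffEDist _ (rhoPseudoEMetric L)
      (stateImage (prodFst A B)) (stateImage (prodSnd A B)) ≤ ENNReal.ofReal r := by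
  refine @Metric.hausdorffEDist_le_of_mem_edist _ (rhoPseudoEMetric L) _ _ _ ?_ ?_
  · intro σ hσ
    obtain ⟨μ, rfl⟩ := mem_stateImage_fst hσ
    obtain ⟨ν, hν⟩ := h.exists_state μ
    exact ⟨_, stateSnd_mem ν, rho_le fun c hc => hν c.1 c.2 hc⟩
  · intro σ hσ
    obtain ⟨ν, rfl⟩ := mem_stateImage_snd hσ
    obtain ⟨μ, hμ⟩ := h.swap.exists_state ν
    exact ⟨_, stateFst_mem μ, rho_le fun c hc => hμ c.2 c.1 hc⟩

end IsCorr

/-- Partners come from the quotient condition. For the order, each state of one space is within `r`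
of a state of the other, so the value of `b` at any state is at least `-r` when its partner `a` is
positive, and states detect positivity. -/
theorem isCorr_of_hausdorffEDist_lt (hL : L ∈ lipNormsInducing LA LB)
    (h : @Metric.hausdorffEDist _ (rhoPseudoEMetric L)
      (stateImage (prodFst A B)) (stateImage (prodSnd A B)) < ENNReal.ofReal r) :
    IsCorr LA LB {p | L (pair p.1 p.2) ≤ 1} r := by
  obtain ⟨hlip, hfst, hsnd⟩ := hL
  have hr : 0 < r := by
    by_contra hr
    rw [ENNReal.ofReal_of_nonpos (not_lt.1 hr)] at h
    exact not_lt_zero h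
  refine ⟨?_, fun a b hab => ?_, fun a b hab s => ?_, fun a b hab => (hfst.le _).trans hab,
    fun a b hab => (hsnd.le _).trans hab, fun a ha => ?_, fun b hb => ?_, fun a b hab ha => ?_,
    fun a b hab hb => ?_⟩
  · rintro p hp q hq x y hx hy hxy
    change L (x • pair p.1 p.2 + y • pair q.1 q.2) ≤ 1
    refine (map_add_le_add L _ _).trans ?_
    rw [map_smul_eq_mul, map_smul_eq_mul, Real.norm_of_nonneg hx, Real.norm_of_nonneg hy]
    have hp : L (pair p.1 p.2) ≤ 1 := hp
    have hq : L (pair q.1 q.2) ≤ 1 := hq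
    nlinarith
  · change L (pair (-a) (-b)) ≤ 1
    rw [pair_neg, map_neg_eq_map]
    exact hab
  · change L (pair a b + s • (A.prod B).unit) ≤ 1
    refine (map_add_le_add L _ _).trans ?_
    rw [hlip.lip_smul_unit, add_zero]
    exact hab
  · obtain ⟨c, rfl, hc⟩ := hfst.exists_lt (fun a => ⟨pair a 0, rfl⟩) ha
    exact ⟨c.2, hc.le, (hsnd.le c).trans_lt hc⟩
  · obtain ⟨c, rfl, hc⟩ := hsnd.exists_lt (fun b => ⟨pair 0 b, rfl⟩) hb
    exact ⟨c.1, hc.le, (hfst.le c).trans_lt hc⟩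
  · refine nonneg_of_forall_state fun ν => ?_
    have h := (@Metric.hausdorffEDist_comm _ (rhoPseudoEMetric L) _ _).trans_lt h
    obtain ⟨σ, hσ, hlt⟩ := @Metric.exists_edist_lt_of_hausdorffEDist_lt _ (rhoPseudoEMetric L) _ _ _
      _ (stateSnd_mem (A := A) ν) h
    obtain ⟨μ, rfl⟩ := mem_stateImage_fst hσ
    have h1 := abs_sub_le_of_rho_le hr.le (le_of_lt hlt) hab
    rw [stateSnd_apply, stateFst_apply] at h1
    rw [map_add, map_smul, ν.2.1, smul_eq_mul, mul_one]
    linarith [μ.nonneg ha, (abs_le.1 h1).1]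
  · refine nonneg_of_forall_state fun μ => ?_
    obtain ⟨σ, hσ, hlt⟩ := @Metric.exists_edist_lt_of_hausdorffEDist_lt _ (rhoPseudoEMetric L) _ _ _
      _ (stateFst_mem (B := B) μ) h
    obtain ⟨ν, rfl⟩ := mem_stateImage_snd hσ
    have h1 := abs_sub_le_of_rho_le hr.le (le_of_lt hlt) hab
    rw [stateSnd_apply, stateFst_apply] at h1
    rw [map_add, map_smul, μ.2.1, smul_eq_mul, mul_one]
    linarith [ν.nonneg hb, (abs_le.1 h1).1]

/-- Any two spaces with Lip-norms admit a correspondence. -/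
theorem exists_isCorr (hA : IsLipNorm LA) (hB : IsLipNorm LB) : ∃ U r, IsCorr LA LB U r := by
  obtain ⟨R, hR0, hR⟩ := hA.exists_radius
  obtain ⟨S, hS0, hS⟩ := hB.exists_radius
  obtain ⟨μ⟩ := exists_state (A := A)
  obtain ⟨ν⟩ := exists_state (A := B)
  have conv : ∀ {D : OrderUnitSpace.{u}} (L : Seminorm ℝ D) {x y : ℝ} {u v : D}, 0 ≤ x → 0 ≤ y →
      x + y = 1 → L u ≤ 1 → L v ≤ 1 → L (x • u + y • v) ≤ 1 := fun L x y u v hx hy hxy hu hv => by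
    refine (map_add_le_add L _ _).trans ?_
    rw [map_smul_eq_mul, map_smul_eq_mul, Real.norm_of_nonneg hx, Real.norm_of_nonneg hy]
    nlinarith
  -- Pairs with equal values at two fixed states. The scalar with the prescribed value always serves
  -- as a partner, and an element of a Lip-ball varies over the states by at most the radius.
  refine ⟨{p | LA p.1 ≤ 1 ∧ LB p.2 ≤ 1 ∧ μ.1 p.1 = ν.1 p.2}, max R S, ⟨?_, fun a b hab => ?_,
    fun a b hab s => ?_, fun a b hab => hab.1, fun a b hab => hab.2.1, fun a ha => ?_,
    fun b hb => ?_, fun a b hab ha => ?_, fun a b hab hb => ?_⟩⟩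
  · rintro p ⟨h1, h2, h3⟩ q ⟨h1', h2', h3'⟩ x y hx hy hxy
    exact ⟨conv LA hx hy hxy h1 h1', conv LB hx hy hxy h2 h2', by simp [h3, h3']⟩
  · simpa using hab
  · refine ⟨(map_add_le_add LA _ _).trans ?_, (map_add_le_add LB _ _).trans ?_, ?_⟩
    · rw [hA.lip_smul_unit, add_zero]; exact hab.1
    · rw [hB.lip_smul_unit, add_zero]; exact hab.2.1
    · have h1 := hab.2.2
      simpa [μ.2.1, ν.2.1] using h1
  · refine ⟨μ.1 a • B.unit, ⟨ha.le, ?_, ?_⟩, ?_⟩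
    · rw [hB.lip_smul_unit]; exact zero_le_one
    · simp [ν.2.1]
    · rw [hB.lip_smul_unit]; exact zero_lt_one
  · refine ⟨ν.1 b • A.unit, ⟨?_, hb.le, ?_⟩, ?_⟩
    · rw [hA.lip_smul_unit]; exact zero_le_one
    · simp [μ.2.1]
    · rw [hA.lip_smul_unit]; exact zero_lt_one
  · refine nonneg_of_forall_state fun τ => ?_
    have h1 := abs_le.1 (hS τ ν b hab.2.1)
    have h2 : μ.1 a = ν.1 b := hab.2.2
    have h3 := μ.nonneg ha
    rw [map_add, map_smul, τ.2.1, smul_eq_mul, mul_one]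
    linarith [le_max_right R S]
  · refine nonneg_of_forall_state fun τ => ?_
    have h1 := abs_le.1 (hR τ μ a hab.1)
    have h2 : μ.1 a = ν.1 b := hab.2.2
    have h3 := ν.nonneg hb
    rw [map_add, map_smul, τ.2.1, smul_eq_mul, mul_one]
    linarith [le_max_left R S]

end OrderUnitSpace

/-! ### Finiteness, symmetry and the triangle inequality -/

namespace CompactQuantumMetricSpace

open OrderUnitSpace

variable {A B C : CompactQuantumMetricSpace.{u}}

/-- Fatten by an arbitrary `ε` to make the set absorbent; the gauge is then an admissible Lip-norm
whose Hausdorff distance is at most `r + ε`. -/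
theorem qDist_le_of_isCorr {U : Set (A.space × B.space)} {r : ℝ}
    (h : IsCorr A.lip B.lip U r) : A.qDist B ≤ ENNReal.ofReal r := by
  refine ENNReal.le_of_forall_pos_le_add fun ε hε _ => ?_
  have hε : 0 < (ε : ℝ) := hε
  have hf := h.fatten A.isLipNorm B.isLipNorm hε.le
  have habs := h.absorbent_fatten hε
  have hL : IsCorr A.lip B.lip {p | (gaugeSeminorm hf.balanced hf.convex habs :
      Seminorm ℝ (A.space.prod B.space)) (pair p.1 p.2) ≤ 1} (r + ε) := hf.gauge habs
  refine (iInf₂_le _ (hL.mem_lipNormsInducing A.isLipNorm B.isLipNorm)).trans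
    (hL.hausdorffEDist_le.trans_eq ?_)
  rw [ENNReal.ofReal_add h.nonneg hε.le, ENNReal.ofReal_coe_nnreal]

theorem exists_isCorr_of_qDist_lt {r : ℝ} (h : A.qDist B < ENNReal.ofReal r) :
    ∃ U, IsCorr A.lip B.lip U r := by
  simp only [qDist, iInf_lt_iff] at h
  obtain ⟨L, hL, hlt⟩ := h
  exact ⟨_, isCorr_of_hausdorffEDist_lt hL hlt⟩

theorem qDist_le_of_forall {r : ℝ≥0∞}
    (h : ∀ s : ℝ, r < ENNReal.ofReal s → ∃ U, IsCorr A.lip B.lip U s) : A.qDist B ≤ r := by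
  refine le_of_forall_gt_imp_ge_of_dense fun t ht => ?_
  rcases eq_or_ne t ∞ with rfl | htop
  · exact le_top
  obtain ⟨U, hU⟩ := h t.toReal (by rwa [ENNReal.ofReal_toReal htop])
  exact (qDist_le_of_isCorr hU).trans_eq (ENNReal.ofReal_toReal htop)

theorem qDist_lt_top (A B : CompactQuantumMetricSpace.{u}) : A.qDist B < ∞ := by
  obtain ⟨U, r, h⟩ := exists_isCorr A.isLipNorm B.isLipNorm
  exact (qDist_le_of_isCorr h).trans_lt ENNReal.ofReal_lt_top

theorem qDist_comm (A B : CompactQuantumMetricSpace.{u}) : A.qDist B = B.qDist A := by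
  have key : ∀ A B : CompactQuantumMetricSpace.{u}, A.qDist B ≤ B.qDist A := fun A B =>
    qDist_le_of_forall fun s hs => by
      obtain ⟨U, hU⟩ := exists_isCorr_of_qDist_lt hs
      exact ⟨_, hU.swap⟩
  exact le_antisymm (key A B) (key B A)

/-- Composition of near-optimal correspondences takes the place of gluing Lip-norms on a triple
direct sum. -/
theorem qDist_triangle (A B C : CompactQuantumMetricSpace.{u}) :
    A.qDist C ≤ A.qDist B + B.qDist C := by
  refine ENNReal.le_of_forall_pos_le_add fun ε hε _ => ?_
  have hε : 0 < (ε : ℝ) := hε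
  have hlt : ∀ A B : CompactQuantumMetricSpace.{u},
      A.qDist B < ENNReal.ofReal ((A.qDist B).toReal + ε / 2) := fun A B => by
    rw [ENNReal.lt_ofReal_iff_toReal_lt (qDist_lt_top A B).ne]
    linarith
  obtain ⟨U, hU⟩ := exists_isCorr_of_qDist_lt (hlt A B)
  obtain ⟨V, hV⟩ := exists_isCorr_of_qDist_lt (hlt B C)
  refine (qDist_le_of_isCorr (hU.comp hV)).trans_eq ?_
  have e : (A.qDist B).toReal + ε / 2 + ((B.qDist C).toReal + ε / 2) =
    (A.qDist B).toReal + (B.qDist C).toReal + ε := by ring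
  rw [e, ENNReal.ofReal_add (by positivity) hε.le, ENNReal.ofReal_add (by positivity)
    (by positivity), ENNReal.ofReal_toReal (qDist_lt_top A B).ne,
    ENNReal.ofReal_toReal (qDist_lt_top B C).ne, ENNReal.ofReal_coe_nnreal]

end CompactQuantumMetricSpace

/-! ### The completion, its cone, and the closed Lip-norm -/

open Pointwise

/-- The positive multiples of a convex balanced set already exhaust its span; this identifies `A^c`
as a union of multiples of the closed Lip-ball. -/
theorem Submodule.exists_pos_mem_smul_of_mem_span {E : Type*} [AddCommGroup E] [Module ℝ E]
    {s : Set E} (hc : Convex ℝ s) (hb : Balanced ℝ s) (hs : s.Nonempty) {x : E}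
    (hx : x ∈ Submodule.span ℝ s) : ∃ t : ℝ, 0 < t ∧ x ∈ t • s := by
  induction hx using Submodule.span_induction with
  | mem x hx => exact ⟨1, zero_lt_one, by simpa using hx⟩
  | zero => exact ⟨1, zero_lt_one, by simpa using hb.zero_mem hs⟩
  | add x y _ _ hx hy =>
    obtain ⟨t, ht, hx⟩ := hx
    obtain ⟨t', ht', hy⟩ := hy
    exact ⟨t + t', by positivity, by
      rw [hc.add_smul ht.le ht'.le]; exact Set.add_mem_add hx hy⟩
  | smul c x _ hx =>
    obtain ⟨t, ht, y, hy, rfl⟩ := hx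
    have hc0 : 0 < |c| + 1 := by positivity
    refine ⟨(|c| + 1) * t, by positivity, (c / (|c| + 1)) • y, hb.smul_mem ?_ hy, ?_⟩
    · rw [Real.norm_eq_abs, abs_div, abs_of_pos hc0, div_le_one hc0]
      linarith
    · simp only [smul_smul]
      congr 1
      field_simp

namespace CompactQuantumMetricSpace

open OrderUnitSpace

variable {A B C : CompactQuantumMetricSpace.{u}}

/-- The isometric embedding of `A` into its completion. -/
noncomputable def incl (A : CompactQuantumMetricSpace.{u}) : A.space →ₗᵢ[ℝ] A.Completion :=
  UniformSpace.Completion.toComplₗᵢ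

theorem exists_norm_sub_incl_lt (x : A.Completion) {ε : ℝ} (hε : 0 < ε) :
    ∃ a, ‖x - A.incl a‖ < ε := by
  obtain ⟨a, ha⟩ := Metric.denseRange_iff.1 UniformSpace.Completion.denseRange_coe x ε hε
  rw [dist_eq_norm] at ha
  exact ⟨a, ha⟩

theorem mem_completionCone_iff {x : A.Completion} :
    x ∈ A.completionCone ↔ ∀ ε : ℝ, 0 < ε → ∃ a, 0 ≤ a ∧ ‖x - A.incl a‖ < ε := by
  simp only [completionCone, Metric.mem_closure_iff, Set.exists_mem_image, dist_eq_norm]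
  rfl

theorem mem_closedLipBall_iff {x : A.Completion} :
    x ∈ A.closedLipBall ↔ ∀ ε : ℝ, 0 < ε → ∃ a, A.lip a ≤ 1 ∧ ‖x - A.incl a‖ < ε := by
  simp only [closedLipBall, Metric.mem_closure_iff, Set.exists_mem_image, dist_eq_norm]
  rfl

theorem mem_smul_closedLipBall_iff {x : A.Completion} {t : ℝ} (ht : 0 < t) :
    x ∈ t • A.closedLipBall ↔ ∀ ε : ℝ, 0 < ε → ∃ a, A.lip a ≤ t ∧ ‖x - A.incl a‖ < ε := by
  rw [Set.mem_smul_set_iff_inv_smul_mem₀ ht.ne', mem_closedLipBall_iff]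
  constructor
  · intro h ε hε
    obtain ⟨a, ha, hxa⟩ := h (ε / t) (by positivity)
    refine ⟨t • a, ?_, ?_⟩
    · rw [map_smul_eq_mul, Real.norm_of_nonneg ht.le]
      exact mul_le_of_le_one_right ht.le ha
    · have e : x - A.incl (t • a) = t • (t⁻¹ • x - A.incl a) := by
        rw [smul_sub, smul_smul, mul_inv_cancel₀ ht.ne', one_smul, map_smul]
      rw [e, norm_smul, Real.norm_of_nonneg ht.le]
      exact (lt_div_iff₀' ht).1 hxa
  · intro h ε hε
    obtain ⟨a, ha, hxa⟩ := h (ε * t) (by positivity)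
    refine ⟨t⁻¹ • a, ?_, ?_⟩
    · rw [map_smul_eq_mul, Real.norm_of_nonneg (inv_nonneg.2 ht.le), inv_mul_le_one₀ ht]
      exact ha
    · rw [map_smul, ← smul_sub, norm_smul, Real.norm_of_nonneg (inv_nonneg.2 ht.le),
        inv_mul_lt_iff₀ ht, mul_comm]
      exact hxa

theorem closedLipBall_eq (A : CompactQuantumMetricSpace.{u}) :
    A.closedLipBall = closure (A.incl '' A.lip.closedBall 0 1) := by
  rw [Seminorm.closedBall_zero_eq]
  rfl

theorem convex_closedLipBall (A : CompactQuantumMetricSpace.{u}) : Convex ℝ A.closedLipBall := by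
  rw [closedLipBall_eq]
  exact ((A.lip.convex_closedBall 0 1).linear_image A.incl.toLinearMap).closure

theorem balanced_closedLipBall (A : CompactQuantumMetricSpace.{u}) :
    Balanced ℝ A.closedLipBall := by
  intro c hc
  rintro _ ⟨x, hx, rfl⟩
  change c • x ∈ _
  rw [mem_closedLipBall_iff] at hx ⊢
  intro ε hε
  obtain ⟨a, ha, hxa⟩ := hx ε hε
  refine ⟨c • a, ?_, ?_⟩
  · rw [map_smul_eq_mul]
    exact (mul_le_of_le_one_left (apply_nonneg _ _) hc).trans ha
  · rw [map_smul, ← smul_sub, norm_smul]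
    exact (mul_le_of_le_one_left (norm_nonneg _) hc).trans_lt hxa

theorem incl_mem_smul_closedLipBall {a : A.space} {t : ℝ} (ht : 0 < t) (ha : A.lip a ≤ t) :
    A.incl a ∈ t • A.closedLipBall :=
  (mem_smul_closedLipBall_iff ht).2 fun ε hε => ⟨a, ha, by simpa using hε⟩

theorem mem_lipClosure_of_mem_smul {x : A.Completion} {t : ℝ} (h : x ∈ t • A.closedLipBall) :
    x ∈ A.lipClosure := by
  obtain ⟨y, hy, rfl⟩ := h
  exact Submodule.smul_mem _ _ (Submodule.subset_span hy)

theorem exists_pos_mem_smul (x : A.lipClosure) :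
    ∃ t : ℝ, 0 < t ∧ (x : A.Completion) ∈ t • A.closedLipBall :=
  Submodule.exists_pos_mem_smul_of_mem_span A.convex_closedLipBall A.balanced_closedLipBall
    ⟨0, mem_closedLipBall_iff.2 fun ε hε => ⟨0, by simp, by simpa using hε⟩⟩ x.2

theorem closedLip_le {x : A.lipClosure} {t : ℝ} (ht : 0 ≤ t)
    (h : (x : A.Completion) ∈ t • A.closedLipBall) : A.closedLip x ≤ t :=
  gauge_le_of_mem ht h

theorem exists_mem_smul_of_closedLip_lt {x : A.lipClosure} {t : ℝ} (h : A.closedLip x < t) :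
    ∃ s : ℝ, 0 < s ∧ s < t ∧ (x : A.Completion) ∈ s • A.closedLipBall := by
  obtain ⟨s, hs, hxs⟩ := exists_pos_mem_smul x
  rw [closedLip, gauge_def] at h
  have hne : {r ∈ Set.Ioi (0 : ℝ) | (x : A.Completion) ∈ r • A.closedLipBall}.Nonempty :=
    ⟨s, hs, hxs⟩
  obtain ⟨r, ⟨hr, hxr⟩, hrt⟩ := exists_lt_of_csInf_lt hne h
  exact ⟨r, hr, hrt, hxr⟩

/-- An element of `A`, as an element of `A^c`. -/
noncomputable def toClosure (A : CompactQuantumMetricSpace.{u}) : A.space →ₗ[ℝ] A.lipClosure :=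
  A.incl.toLinearMap.codRestrict A.lipClosure fun a =>
    mem_lipClosure_of_mem_smul (t := A.lip a + 1) (incl_mem_smul_closedLipBall
      (by have := apply_nonneg A.lip a; positivity) (by linarith))

theorem toClosure_unit : A.toClosure A.space.unit = A.closureUnit := rfl

theorem coe_closureUnit : (A.closureUnit : A.Completion) = A.incl A.space.unit := rfl

theorem closedLip_toClosure_le (a : A.space) : A.closedLip (A.toClosure a) ≤ A.lip a := by
  refine le_of_forall_gt_imp_ge_of_dense fun t ht => ?_
  have ht0 : 0 < t := (apply_nonneg _ _).trans_lt ht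
  exact closedLip_le ht0.le (incl_mem_smul_closedLipBall ht0 ht.le)

/-- Together with `mem_completionCone_of_forall`, this reads positivity in the completion off
approximations in `A`, at the cost of a multiple of the unit. -/
theorem nonneg_of_mem_completionCone {x : A.Completion} (hx : x ∈ A.completionCone) {a : A.space}
    {ε : ℝ} (ha : ‖x - A.incl a‖ ≤ ε) : 0 ≤ a + ε • A.space.unit := by
  refine nonneg_of_forall_pos fun δ hδ => ?_
  obtain ⟨b, hb, hxb⟩ := mem_completionCone_iff.1 hx δ hδ
  have h1 : ‖a - b‖ ≤ ε + δ := by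
    rw [← A.incl.norm_map, map_sub]
    have e : A.incl a - A.incl b = -(x - A.incl a) + (x - A.incl b) := by abel
    rw [e]
    refine (norm_add_le _ _).trans ?_
    rw [norm_neg]
    linarith
  have h2 := add_nonneg hb (norm_le_iff.1 h1).1
  refine h2.trans_eq ?_
  module

theorem mem_completionCone_of_forall {x : A.Completion} (h : ∀ ε : ℝ, 0 < ε → ∃ a : A.space,
    0 ≤ a + ε • A.space.unit ∧ ‖x - A.incl a‖ ≤ ε) : x ∈ A.completionCone := by
  rw [mem_completionCone_iff]
  intro ε hε
  obtain ⟨a, ha, hxa⟩ := h (ε / 3) (by positivity)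
  refine ⟨_, ha, ?_⟩
  rw [map_add, ← sub_sub]
  refine (norm_sub_le _ _).trans_lt ?_
  rw [A.incl.norm_map, norm_smul, norm_unit, Real.norm_of_nonneg (by positivity)]
  linarith

theorem incl_mem_completionCone {a : A.space} (ha : 0 ≤ a) : A.incl a ∈ A.completionCone :=
  mem_completionCone_iff.2 fun ε hε => ⟨a, ha, by simpa using hε⟩

/-- The completed norm is still the order-unit norm of the closed cone, so unital order isomorphisms
preserve it. -/
theorem norm_le_iff_mem_completionCone {x : A.Completion} {t : ℝ} :
    ‖x‖ ≤ t ↔ x + t • A.incl A.space.unit ∈ A.completionCone ∧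
      -x + t • A.incl A.space.unit ∈ A.completionCone := by
  constructor
  · have key : ∀ x : A.Completion, ‖x‖ ≤ t → x + t • A.incl A.space.unit ∈ A.completionCone := by
      intro x hx
      refine mem_completionCone_of_forall fun ε hε => ?_
      obtain ⟨a, ha⟩ := exists_norm_sub_incl_lt x hε
      refine ⟨a + t • A.space.unit, ?_, ?_⟩
      · have h1 : ‖a‖ ≤ t + ε := by
          rw [← A.incl.norm_map]
          have e : A.incl a = x - (x - A.incl a) := by abel
          rw [e]
          exact (norm_sub_le _ _).trans (by linarith)
        rw [add_assoc, ← add_smul]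
        exact (norm_le_iff.1 h1).1
      · rw [map_add, map_smul, add_sub_add_right_eq_sub]
        exact ha.le
    exact fun hx => ⟨key x hx, key (-x) (by rwa [norm_neg])⟩
  · rintro ⟨h1, h2⟩
    refine le_of_forall_pos_le_add fun ε hε => ?_
    obtain ⟨a, ha⟩ := exists_norm_sub_incl_lt x (half_pos hε)
    have h3 := nonneg_of_mem_completionCone h1 (a := a + t • A.space.unit) (ε := ε / 2) (by
      rw [map_add, map_smul, add_sub_add_right_eq_sub]
      exact ha.le)
    have h4 := nonneg_of_mem_completionCone h2 (a := -a + t • A.space.unit) (ε := ε / 2) (by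
      rw [map_add, map_smul, add_sub_add_right_eq_sub, map_neg, ← neg_sub', norm_neg]
      exact ha.le)
    rw [add_assoc, ← add_smul] at h3 h4
    have h5 := norm_le_iff.2 ⟨h3, h4⟩
    rw [← A.incl.norm_map] at h5
    have e : x = (x - A.incl a) + A.incl a := by abel
    rw [e]
    exact (norm_add_le _ _).trans (by linarith)

theorem eq_zero_of_mem_completionCone {x : A.Completion} (h1 : x ∈ A.completionCone)
    (h2 : -x ∈ A.completionCone) : x = 0 := by
  rw [← norm_le_zero_iff, norm_le_iff_mem_completionCone]
  simpa using ⟨h1, h2⟩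

/-! ### Isometric spaces are at distance zero -/

namespace Isometry

/-- The inverse of an isometry. -/
noncomputable def symm (φ : Isometry A B) : Isometry B A where
  toLinearEquiv := φ.toLinearEquiv.symm
  map_cone_iff x := by
    have h := φ.map_cone_iff (φ.toLinearEquiv.symm x)
    rw [LinearEquiv.apply_symm_apply] at h
    exact h.symm
  map_unit := by
    rw [LinearEquiv.symm_apply_eq]
    exact φ.map_unit.symm
  closedLip_map x := by
    have h := φ.closedLip_map (φ.toLinearEquiv.symm x)
    rw [LinearEquiv.apply_symm_apply] at h
    exact h.symm

theorem norm_map_le (φ : Isometry A B) (x : A.lipClosure) : ‖φ.toLinearEquiv x‖ ≤ ‖x‖ := by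
  have h := norm_le_iff_mem_completionCone.1 (le_refl ‖(x : A.Completion)‖)
  have h1 := (φ.map_cone_iff (x + ‖(x : A.Completion)‖ • A.closureUnit)).2 h.1
  have h2 := (φ.map_cone_iff (-x + ‖(x : A.Completion)‖ • A.closureUnit)).2 h.2
  rw [map_add, map_smul, φ.map_unit] at h1 h2
  rw [map_neg] at h2
  exact norm_le_iff_mem_completionCone.2 ⟨h1, h2⟩

theorem norm_map (φ : Isometry A B) (x : A.lipClosure) : ‖φ.toLinearEquiv x‖ = ‖x‖ := by
  refine le_antisymm (φ.norm_map_le x) ?_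
  have := φ.symm.norm_map_le (φ.toLinearEquiv x)
  rwa [symm, LinearEquiv.symm_apply_apply] at this

/-- The image has closed Lip-norm less than `1`, so it lies in a multiple `s < 1` of the closed
ball, and approximants in `B` with Lip-norm at most `s` exist. -/
theorem exists_near (φ : Isometry A B) {a : A.space} (ha : A.lip a < 1) {ε : ℝ} (hε : 0 < ε) :
    ∃ b, B.lip b < 1 ∧ ‖φ.toLinearEquiv (A.toClosure a) - B.toClosure b‖ ≤ ε := by
  have h1 : B.closedLip (φ.toLinearEquiv (A.toClosure a)) < 1 := by
    rw [φ.closedLip_map]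
    exact (closedLip_toClosure_le a).trans_lt ha
  obtain ⟨s, hs, hs1, hmem⟩ := exists_mem_smul_of_closedLip_lt h1
  obtain ⟨b, hb, hb'⟩ := (mem_smul_closedLipBall_iff hs).1 hmem ε hε
  exact ⟨b, hb.trans_lt hs1, hb'.le⟩

/-- The image of `A` need not meet `B` in enough elements, so the graph of `φ` is replaced by the
pairs that match up to `ε`. -/
theorem isCorr (φ : Isometry A B) {ε : ℝ} (hε : 0 < ε) :
    IsCorr A.lip B.lip {p | A.lip p.1 ≤ 1 ∧ B.lip p.2 ≤ 1 ∧
      ‖φ.toLinearEquiv (A.toClosure p.1) - B.toClosure p.2‖ ≤ ε} ε := by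
  have hU : {p : A.space × B.space | A.lip p.1 ≤ 1 ∧ B.lip p.2 ≤ 1 ∧
      ‖φ.toLinearEquiv (A.toClosure p.1) - B.toClosure p.2‖ ≤ ε} =
      (LinearMap.fst ℝ A.space B.space) ⁻¹' A.lip.closedBall 0 1 ∩
      ((LinearMap.snd ℝ A.space B.space) ⁻¹' B.lip.closedBall 0 1 ∩
      (φ.toLinearEquiv.toLinearMap ∘ₗ A.toClosure ∘ₗ LinearMap.fst ℝ A.space B.space -
        B.toClosure ∘ₗ LinearMap.snd ℝ A.space B.space) ⁻¹' Metric.closedBall 0 ε) := by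
    ext p
    simp only [Set.mem_inter_iff, Set.mem_preimage, mem_closedBall_zero_iff,
      Seminorm.mem_closedBall_zero]
    rfl
  have hflip : ∀ (a : A.space) (b : B.space),
      ‖φ.toLinearEquiv (A.toClosure a) - B.toClosure b‖ =
      ‖φ.symm.toLinearEquiv (B.toClosure b) - A.toClosure a‖ := fun a b => by
    rw [← φ.norm_map, map_sub, symm, LinearEquiv.apply_symm_apply, norm_sub_rev]
  refine ⟨?_, fun a b hab => ?_, fun a b hab s => ?_, fun a b hab => hab.1, fun a b hab => hab.2.1,
    fun a ha => ?_, fun b hb => ?_, fun a b hab ha => ?_, fun a b hab hb => ?_⟩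
  · rw [hU]
    exact ((A.lip.convex_closedBall 0 1).linear_preimage _).inter
      (((B.lip.convex_closedBall 0 1).linear_preimage _).inter
        ((convex_closedBall 0 ε).linear_preimage _))
  · obtain ⟨h1, h2, h3⟩ := hab
    refine ⟨by simpa using h1, by simpa using h2, ?_⟩
    simp only [map_neg, ← neg_sub', norm_neg]
    exact h3
  · obtain ⟨h1, h2, h3⟩ := hab
    refine ⟨(map_add_le_add A.lip _ _).trans ?_, (map_add_le_add B.lip _ _).trans ?_, ?_⟩
    · rw [A.isLipNorm.lip_smul_unit, add_zero]; exact h1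
    · rw [B.isLipNorm.lip_smul_unit, add_zero]; exact h2
    · simp only [map_add, map_smul, toClosure_unit, φ.map_unit, add_sub_add_right_eq_sub]
      exact h3
  · obtain ⟨b, hb, hab⟩ := φ.exists_near ha hε
    exact ⟨b, ⟨ha.le, hb.le, hab⟩, hb⟩
  · obtain ⟨a, ha, hab⟩ := φ.symm.exists_near hb hε
    exact ⟨a, ⟨ha.le, hb.le, (hflip a b).trans_le hab⟩, ha⟩
  · exact nonneg_of_mem_completionCone
      ((φ.map_cone_iff (A.toClosure a)).2 (incl_mem_completionCone ha)) hab.2.2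
  · exact nonneg_of_mem_completionCone
      ((φ.symm.map_cone_iff (B.toClosure b)).2 (incl_mem_completionCone hb))
      ((hflip a b).symm.trans_le hab.2.2)

theorem qDist_eq_zero (φ : Isometry A B) : A.qDist B = 0 := by
  rw [← le_zero_iff]
  refine qDist_le_of_forall fun s hs => ?_
  exact ⟨_, φ.isCorr (ENNReal.ofReal_pos.1 hs)⟩

end Isometry

/-! ### Distance zero implies isometric: ultralimits of correspondences -/

/-- `LimitRel U t x y` says that `(x, y)` is, along a fixed ultrafilter, a limit of elements of
`t • U n`. -/
def LimitRel (U : ℕ → Set (A.space × B.space)) (t : ℝ) (x : A.Completion) (y : B.Completion) :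
    Prop :=
  ∀ ε : ℝ, 0 < ε → ∀ᶠ n in (hyperfilter ℕ : Filter ℕ), ∃ a b, (a, b) ∈ U n ∧
    ‖x - A.incl (t • a)‖ < ε ∧ ‖y - B.incl (t • b)‖ < ε

namespace LimitRel

variable {U : ℕ → Set (A.space × B.space)} {r : ℕ → ℝ} {t : ℝ} {x : A.Completion}
  {y : B.Completion}

theorem swap (h : LimitRel U t x y) : LimitRel (fun n => Prod.swap ⁻¹' U n) t y x := fun ε hε => by
  filter_upwards [h ε hε] with n ⟨a, b, hab, ha, hb⟩
  exact ⟨b, a, hab, hb, ha⟩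

theorem zero (hU : ∀ n, IsCorr A.lip B.lip (U n) (r n)) : LimitRel U 1 0 0 := fun ε hε =>
  Eventually.of_forall fun n => ⟨0, 0, (hU n).zero_mem, by simpa using hε, by simpa using hε⟩

theorem add (hU : ∀ n, IsCorr A.lip B.lip (U n) (r n)) (h : LimitRel U t x y) {t' : ℝ}
    {x' : A.Completion} {y' : B.Completion} (h' : LimitRel U t' x' y') (ht : 0 < t) (ht' : 0 < t') :
    LimitRel U (t + t') (x + x') (y + y') := fun ε hε => by
  filter_upwards [h (ε / 2) (half_pos hε), h' (ε / 2) (half_pos hε)] with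
    n ⟨a, b, hab, ha, hb⟩ ⟨a', b', hab', ha', hb'⟩
  have key : ∀ {D : CompactQuantumMetricSpace.{u}} {z z' : D.Completion} {c c' : D.space},
      ‖z - D.incl (t • c)‖ < ε / 2 → ‖z' - D.incl (t' • c')‖ < ε / 2 →
      ‖z + z' - D.incl ((t + t') • ((t / (t + t')) • c + (t' / (t + t')) • c'))‖ < ε := by
    intro D z z' c c' h1 h2
    have e : z + z' - D.incl ((t + t') • ((t / (t + t')) • c + (t' / (t + t')) • c')) =
        (z - D.incl (t • c)) + (z' - D.incl (t' • c')) := by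
      rw [smul_add, smul_smul, smul_smul, mul_div_cancel₀ _ (by positivity),
        mul_div_cancel₀ _ (by positivity), map_add]
      abel
    rw [e]
    exact (norm_add_le _ _).trans_lt (by linarith)
  exact ⟨_, _, (hU n).convex hab hab' (by positivity) (by positivity) (by field_simp),
    key ha ha', key hb hb'⟩

theorem smul (hU : ∀ n, IsCorr A.lip B.lip (U n) (r n)) (h : LimitRel U t x y) (c : ℝ) :
    LimitRel U ((|c| + 1) * t) (c • x) (c • y) := fun ε hε => by
  have hc0 : 0 < |c| + 1 := by positivity
  filter_upwards [h (ε / (|c| + 1)) (by positivity)] with n ⟨a, b, hab, ha, hb⟩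
  have key : ∀ {D : CompactQuantumMetricSpace.{u}} {z : D.Completion} {d : D.space},
      ‖z - D.incl (t • d)‖ < ε / (|c| + 1) →
      ‖c • z - D.incl (((|c| + 1) * t) • (c / (|c| + 1)) • d)‖ < ε := by
    intro D z d h1
    have e : ((|c| + 1) * t) • (c / (|c| + 1)) • d = c • t • d := by
      simp only [smul_smul]
      congr 1
      field_simp
    rw [e, map_smul, ← smul_sub, norm_smul, Real.norm_eq_abs]
    rw [lt_div_iff₀ hc0] at h1
    nlinarith [norm_nonneg (z - D.incl (t • d))]
  refine ⟨_, _, (hU n).balanced.smul_mem (a := c / (|c| + 1)) ?_ hab, key ha, key hb⟩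
  rw [Real.norm_eq_abs, abs_div, abs_of_pos hc0, div_le_one hc0]
  linarith

theorem snd_mem_smul (hU : ∀ n, IsCorr A.lip B.lip (U n) (r n)) (h : LimitRel U t x y)
    (ht : 0 < t) : y ∈ t • B.closedLipBall := by
  rw [mem_smul_closedLipBall_iff ht]
  intro ε hε
  obtain ⟨n, a, b, hab, -, hb⟩ := (h ε hε).exists
  refine ⟨t • b, ?_, hb⟩
  rw [map_smul_eq_mul, Real.norm_of_nonneg ht.le]
  exact mul_le_of_le_one_right ht.le ((hU n).lip_snd _ _ hab)

theorem snd_mem_completionCone (hU : ∀ n, IsCorr A.lip B.lip (U n) (r n))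
    (hr : Tendsto r atTop (𝓝 0)) (h : LimitRel U t x y) (ht : 0 < t)
    (hx : x ∈ A.completionCone) : y ∈ B.completionCone := by
  refine mem_completionCone_of_forall fun ε hε => ?_
  have h1 : ∀ᶠ n in (hyperfilter ℕ : Filter ℕ), r n < ε / (2 * t) :=
    Nat.hyperfilter_le_atTop (hr.eventually (gt_mem_nhds (by positivity)))
  obtain ⟨n, ⟨a, b, hab, ha, hb⟩, hn⟩ := ((h (ε / 2) (half_pos hε)).and h1).exists
  refine ⟨t • b, ?_, hb.le.trans (by linarith)⟩
  have h2 := nonneg_of_mem_completionCone hx ha.le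
  have h3 : 0 ≤ a + (ε / (2 * t)) • A.space.unit := by
    have := smul_nonneg (inv_nonneg.2 ht.le) h2
    refine this.trans_eq ?_
    match_scalars <;> field_simp
  have h4 := smul_nonneg ht.le ((hU n).nonneg_snd_add hab h3)
  rw [smul_add, smul_smul] at h4
  refine nonneg_mono h4 ?_
  rw [lt_div_iff₀ (by positivity)] at hn
  have e : t * (ε / (2 * t) + r n) = ε / 2 + t * r n := by field_simp
  rw [e]
  linarith

/-- Approximate `x` by elements of Lip-norm at most `t`. Division by `t' > t` puts them in the open
Lip-ball, where they have partners; these are bounded in norm and thus stay in a totally bounded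
set, so they converge along the ultrafilter. -/
theorem exists_of_mem_smul (hU : ∀ n, IsCorr A.lip B.lip (U n) (r n))
    (hr : Tendsto r atTop (𝓝 0)) (ht : 0 < t) {t' : ℝ} (htt : t < t')
    (hx : x ∈ t • A.closedLipBall) : ∃ y, LimitRel U t' x y := by
  have ht' : 0 < t' := ht.trans htt
  have hpos : ∀ n : ℕ, (0 : ℝ) < 1 / (n + 1) := fun n => by positivity
  choose a ha hxa using fun n : ℕ => (mem_smul_closedLipBall_iff ht).1 hx (1 / (n + 1)) (hpos n)
  have hlt : ∀ n, A.lip (t'⁻¹ • a n) < 1 := fun n => by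
    rw [map_smul_eq_mul, Real.norm_of_nonneg (inv_nonneg.2 ht'.le), inv_mul_lt_one₀ ht']
    exact (ha n).trans_lt htt
  choose b hab hb using fun n => (hU n).exists_snd _ (hlt n)
  obtain ⟨R, hR⟩ := hr.bddAbove_range
  have hnorm : ∀ n, ‖b n‖ ≤ t'⁻¹ * (‖x‖ + 1) + R := fun n => by
    have h1 := (hU n).norm_snd_le (hab n)
    have h2 : r n ≤ R := hR ⟨n, rfl⟩
    have h3 : ‖a n‖ ≤ ‖x‖ + 1 := by
      rw [← A.incl.norm_map]
      have e : A.incl (a n) = x - (x - A.incl (a n)) := by abel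
      rw [e]
      refine (norm_sub_le _ _).trans (add_le_add_right ((hxa n).le.trans ?_) _)
      rw [div_le_one (by positivity)]
      linarith [n.cast_nonneg (α := ℝ)]
    rw [norm_smul, Real.norm_of_nonneg (inv_nonneg.2 ht'.le)] at h1
    have h4 : t'⁻¹ * ‖a n‖ ≤ t'⁻¹ * (‖x‖ + 1) := by gcongr
    linarith
  have htb := (B.isLipNorm.totallyBounded (t'⁻¹ * (‖x‖ + 1) + R)).image
    B.incl.isometry.uniformContinuous
  have hcomp := htb.closure.isCompact_of_isClosed isClosed_closure
  obtain ⟨z, -, hz⟩ := hcomp.ultrafilter_le_nhds ((hyperfilter ℕ).map fun n => B.incl (b n)) (by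
    rw [le_principal_iff]
    exact Eventually.of_forall (f := (hyperfilter ℕ : Filter ℕ)) fun n =>
      subset_closure ⟨b n, ⟨(hb n).le, hnorm n⟩, rfl⟩)
  have hz' : Tendsto (fun n => B.incl (b n)) (hyperfilter ℕ : Filter ℕ) (𝓝 z) := hz
  refine ⟨t' • z, fun ε hε => ?_⟩
  have h1 : ∀ᶠ n : ℕ in (hyperfilter ℕ : Filter ℕ), (1 : ℝ) / (n + 1) < ε :=
    Nat.hyperfilter_le_atTop
      ((tendsto_one_div_add_atTop_nhds_zero_nat (𝕜 := ℝ)).eventually (gt_mem_nhds hε))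
  filter_upwards [h1, Metric.tendsto_nhds.1 hz' (ε / t') (by positivity)] with n hn1 hn2
  refine ⟨_, _, hab n, ?_, ?_⟩
  · rw [smul_smul, mul_inv_cancel₀ ht'.ne', one_smul]
    exact (hxa n).trans hn1
  · rw [map_smul, ← smul_sub, norm_smul, Real.norm_of_nonneg ht'.le, ← dist_eq_norm, dist_comm,
      ← lt_div_iff₀' ht']
    exact hn2

/-- The limit relation preserves positivity exactly. As `0` and `-0` are both positive, so are `y`
and `-y`. By linearity this makes the relation single-valued. -/
theorem snd_eq_zero (hU : ∀ n, IsCorr A.lip B.lip (U n) (r n))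
    (hr : Tendsto r atTop (𝓝 0)) (h : LimitRel U t 0 y) (ht : 0 < t) : y = 0 := by
  have h0 : (0 : A.Completion) ∈ A.completionCone := by
    simpa using incl_mem_completionCone (A := A) le_rfl
  refine eq_zero_of_mem_completionCone (h.snd_mem_completionCone hU hr ht h0) ?_
  have := (h.smul hU (-1)).snd_mem_completionCone hU hr (by positivity) (by simpa using h0)
  simpa using this

end LimitRel

/-- The pairs in `A^c × B^c` that are limits of multiples of elements of `U n`. -/
noncomputable def limitGraph (U : ℕ → Set (A.space × B.space)) {r : ℕ → ℝ}
    (hU : ∀ n, IsCorr A.lip B.lip (U n) (r n)) : Submodule ℝ (A.lipClosure × B.lipClosure) where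
  carrier := {p | ∃ t : ℝ, 0 < t ∧ LimitRel U t (p.1 : A.Completion) (p.2 : B.Completion)}
  zero_mem' := ⟨1, zero_lt_one, LimitRel.zero hU⟩
  add_mem' := by
    rintro p q ⟨t, ht, hp⟩ ⟨t', ht', hq⟩
    exact ⟨t + t', by positivity, hp.add hU hq ht ht'⟩
  smul_mem' := by
    rintro c p ⟨t, ht, hp⟩
    exact ⟨(|c| + 1) * t, by positivity, hp.smul hU c⟩

section

variable {U : ℕ → Set (A.space × B.space)} {r : ℕ → ℝ}

theorem swap_mem_limitGraph (hU : ∀ n, IsCorr A.lip B.lip (U n) (r n))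
    {p : A.lipClosure × B.lipClosure} (hp : p ∈ limitGraph U hU) :
    p.swap ∈ limitGraph (fun n => Prod.swap ⁻¹' U n) fun n => (hU n).swap := by
  obtain ⟨t, ht, hp⟩ := hp
  exact ⟨t, ht, hp.swap⟩

theorem exists_mem_limitGraph (hU : ∀ n, IsCorr A.lip B.lip (U n) (r n))
    (hr : Tendsto r atTop (𝓝 0)) {x : A.lipClosure} {t t' : ℝ} (ht : 0 < t) (htt : t < t')
    (hx : (x : A.Completion) ∈ t • A.closedLipBall) :
    ∃ y : B.lipClosure, (x, y) ∈ limitGraph U hU ∧ (y : B.Completion) ∈ t' • B.closedLipBall := by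
  obtain ⟨y, hy⟩ := LimitRel.exists_of_mem_smul hU hr ht htt hx
  have hmem := hy.snd_mem_smul hU (ht.trans htt)
  exact ⟨⟨y, mem_lipClosure_of_mem_smul hmem⟩, ⟨t', ht.trans htt, hy⟩, hmem⟩

theorem snd_eq_zero_of_mem_limitGraph (hU : ∀ n, IsCorr A.lip B.lip (U n) (r n))
    (hr : Tendsto r atTop (𝓝 0)) {y : B.lipClosure} (h : (0, y) ∈ limitGraph U hU) : y = 0 := by
  obtain ⟨t, ht, h⟩ := h
  exact Subtype.ext (LimitRel.snd_eq_zero hU hr h ht)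

theorem bijective_fst_limitGraph (hU : ∀ n, IsCorr A.lip B.lip (U n) (r n))
    (hr : Tendsto r atTop (𝓝 0)) :
    Function.Bijective (LinearMap.fst ℝ A.lipClosure B.lipClosure ∘ₗ (limitGraph U hU).subtype) := by
  constructor
  · rw [← LinearMap.ker_eq_bot, LinearMap.ker_eq_bot']
    rintro ⟨⟨x, y⟩, hxy⟩ h
    obtain rfl : x = 0 := h
    obtain rfl := snd_eq_zero_of_mem_limitGraph hU hr hxy
    rfl
  · intro x
    obtain ⟨t, ht, hx⟩ := exists_pos_mem_smul x
    obtain ⟨y, hy, -⟩ := exists_mem_limitGraph hU hr ht (lt_add_one t) hx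
    exact ⟨⟨(x, y), hy⟩, rfl⟩

theorem bijective_snd_limitGraph (hU : ∀ n, IsCorr A.lip B.lip (U n) (r n))
    (hr : Tendsto r atTop (𝓝 0)) :
    Function.Bijective (LinearMap.snd ℝ A.lipClosure B.lipClosure ∘ₗ (limitGraph U hU).subtype) := by
  have h := bijective_fst_limitGraph (fun n => (hU n).swap) hr
  constructor
  · intro p q hpq
    have := @h.1 ⟨p.1.swap, swap_mem_limitGraph hU p.2⟩ ⟨q.1.swap, swap_mem_limitGraph hU q.2⟩ hpq
    exact Subtype.ext (Prod.swap_injective (congrArg Subtype.val this))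
  · intro y
    obtain ⟨p, hp⟩ := h.2 y
    exact ⟨⟨p.1.swap, swap_mem_limitGraph (fun n => (hU n).swap) p.2⟩, hp⟩

/-- Compactness gives a partner of `x` with Lip-radius as close to that of `x` as desired, and
uniqueness of partners identifies it with `y`. -/
theorem closedLip_snd_le (hU : ∀ n, IsCorr A.lip B.lip (U n) (r n))
    (hr : Tendsto r atTop (𝓝 0)) {x : A.lipClosure} {y : B.lipClosure}
    (h : (x, y) ∈ limitGraph U hU) : B.closedLip y ≤ A.closedLip x := by
  refine le_of_forall_gt_imp_ge_of_dense fun t ht => ?_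
  obtain ⟨s, hs, hst, hx⟩ := exists_mem_smul_of_closedLip_lt ht
  obtain ⟨y', hy', hmem⟩ := exists_mem_limitGraph hU hr hs hst hx
  have h0 : (x, y) - (x, y') ∈ limitGraph U hU := Submodule.sub_mem _ h hy'
  rw [Prod.mk_sub_mk, sub_self] at h0
  rw [sub_eq_zero.1 (snd_eq_zero_of_mem_limitGraph hU hr h0)]
  exact closedLip_le (hs.trans hst).le hmem

/-- The isometry is the map with graph `limitGraph`; both projections of the graph are bijective.
Every one-sided statement, applied to the swapped correspondences, yields its converse. -/
theorem nonempty_isometry_of_isCorr (hU : ∀ n, IsCorr A.lip B.lip (U n) (r n))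
    (hr : Tendsto r atTop (𝓝 0)) : Nonempty (Isometry A B) := by
  set e₁ := LinearEquiv.ofBijective _ (bijective_fst_limitGraph hU hr) with he₁
  set e₂ := LinearEquiv.ofBijective _ (bijective_snd_limitGraph hU hr) with he₂
  have hmem : ∀ x, (x, (e₁.symm.trans e₂) x) ∈ limitGraph U hU := fun x => by
    have h1 : (e₁.symm x).1.1 = x := e₁.apply_symm_apply x
    have h2 : (x, (e₁.symm.trans e₂) x) = (e₁.symm x).1 := Prod.ext h1.symm rfl
    rw [h2]
    exact (e₁.symm x).2
  have hmem' := fun x => swap_mem_limitGraph hU (hmem x)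
  have hU' := fun n => (hU n).swap
  refine ⟨⟨e₁.symm.trans e₂, fun x => ⟨fun h => ?_, fun h => ?_⟩, ?_, fun x => le_antisymm ?_ ?_⟩⟩
  · obtain ⟨t, ht, hrel⟩ := hmem' x
    exact hrel.snd_mem_completionCone hU' hr ht h
  · obtain ⟨t, ht, hrel⟩ := hmem x
    exact hrel.snd_mem_completionCone hU hr ht h
  · have h1 : (A.closureUnit, B.closureUnit) ∈ limitGraph U hU := by
      refine ⟨1, zero_lt_one, fun ε hε => Eventually.of_forall fun n => ⟨A.space.unit, B.space.unit,
        ?_, ?_⟩⟩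
      · simpa using (hU n).add_unit 0 0 (hU n).zero_mem 1
      · simpa [coe_closureUnit] using hε
    have h2 := Submodule.sub_mem _ (hmem A.closureUnit) h1
    rw [Prod.mk_sub_mk, sub_self] at h2
    exact sub_eq_zero.1 (snd_eq_zero_of_mem_limitGraph hU hr h2)
  · exact closedLip_snd_le hU hr (hmem x)
  · exact closedLip_snd_le hU' hr (hmem' x)

end

theorem nonempty_isometry_of_qDist_eq_zero (h : A.qDist B = 0) : Nonempty (Isometry A B) := by
  choose U hU using fun n : ℕ => exists_isCorr_of_qDist_lt (A := A) (B := B) (r := 1 / (n + 1))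
    (by rw [h]; exact ENNReal.ofReal_pos.2 (by positivity))
  exact nonempty_isometry_of_isCorr hU tendsto_one_div_add_atTop_nhds_zero_nat

end CompactQuantumMetricSpace

/-! ### The order-unit space of a convex cone -/

namespace OrderUnitSpace

section OfCone

variable {V : Type u} [AddCommGroup V] [Module ℝ V]

/-- The lineality space `P ∩ -P` of a convex cone. -/
def linealitySpace (P : PointedCone ℝ V) : Submodule ℝ V where
  carrier := {v | v ∈ P ∧ -v ∈ P}
  zero_mem' := by simp
  add_mem' := by
    rintro v w ⟨h1, h2⟩ ⟨h3, h4⟩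
    refine ⟨P.add_mem h1 h3, ?_⟩
    rw [neg_add]
    exact P.add_mem h2 h4
  smul_mem' := by
    rintro c v ⟨h1, h2⟩
    rcases le_total 0 c with hc | hc
    · have h3 := P.smul_mem hc h1
      have h4 := P.smul_mem hc h2
      exact ⟨h3, by rw [← smul_neg]; exact h4⟩
    · have h3 := P.smul_mem (neg_nonneg.2 hc) h1
      have h4 := P.smul_mem (neg_nonneg.2 hc) h2
      rw [smul_neg, neg_smul, neg_neg] at h4
      rw [neg_smul] at h3
      exact ⟨h4, h3⟩

theorem mk_eq_mk_iff {P : PointedCone ℝ V} {v w : V} :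
    (linealitySpace P).mkQ v = (linealitySpace P).mkQ w ↔ v - w ∈ P ∧ w - v ∈ P := by
  rw [Submodule.mkQ_apply, Submodule.mkQ_apply, Submodule.Quotient.eq, ← neg_sub v w]
  rfl

/-- The order on the quotient of a vector space by the lineality space of a convex cone. -/
abbrev conePartialOrder (P : PointedCone ℝ V) : PartialOrder (V ⧸ linealitySpace P) where
  le x y := ∃ v ∈ P, (linealitySpace P).mkQ v = y - x
  le_refl x := ⟨0, P.zero_mem, by simp⟩
  le_trans := by
    rintro x y z ⟨v, hv, hxy⟩ ⟨w, hw, hyz⟩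
    exact ⟨v + w, P.add_mem hv hw, by rw [map_add, hxy, hyz]; abel⟩
  le_antisymm := by
    rintro x y ⟨v, hv, hxy⟩ ⟨w, hw, hyx⟩
    have h : (linealitySpace P).mkQ v = (linealitySpace P).mkQ (-w) := by
      rw [map_neg, hxy, hyx, neg_sub]
    have h1 := (mk_eq_mk_iff.1 h).2
    have h2 : -v ∈ P := by
      have e : -v = (-w - v) + w := by abel
      rw [e]
      exact P.add_mem h1 hw
    have h3 : (linealitySpace P).mkQ v = 0 := by
      rw [← map_zero (linealitySpace P).mkQ, mk_eq_mk_iff]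
      simpa using ⟨hv, h2⟩
    rw [h3] at hxy
    exact (sub_eq_zero.1 hxy.symm).symm

theorem cone_le_iff {P : PointedCone ℝ V} {v w : V} :
    (conePartialOrder P).le ((linealitySpace P).mkQ v) ((linealitySpace P).mkQ w) ↔ w - v ∈ P := by
  constructor
  · rintro ⟨u, hu, h⟩
    rw [← map_sub, mk_eq_mk_iff] at h
    have := P.add_mem h.2 hu
    simpa using this
  · intro h
    exact ⟨_, h, map_sub _ _ _⟩

/-- The order-unit space obtained from a convex cone and an Archimedean order unit by dividing out
the lineality space. -/
def ofCone (P : PointedCone ℝ V) (e : V) (he : e ∈ P) (hne : -e ∉ P)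
    (hunit : ∀ v, ∃ r : ℝ, r • e - v ∈ P)
    (harch : ∀ v, (∀ r : ℝ, 0 < r → r • e - v ∈ P) → -v ∈ P) : OrderUnitSpace.{u} :=
  letI := conePartialOrder P
  { carrier := V ⧸ linealitySpace P
    isOrderedAddMonoid := ⟨by
      rintro x y ⟨v, hv, h⟩ z
      exact ⟨v, hv, by rw [h]; abel⟩, by
      rintro x y ⟨v, hv, h⟩ z
      exact ⟨v, hv, by rw [h]; abel⟩⟩
    posSMulMono := ⟨by
      rintro r hr x y ⟨v, hv, h⟩
      refine ⟨r • v, P.smul_mem hr hv, ?_⟩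
      change _ = r • y - r • x
      rw [map_smul, h, smul_sub]⟩
    unit := (linealitySpace P).mkQ e
    unit_pos := by
      refine lt_of_le_of_ne ⟨e, he, by simp⟩ fun h => hne ?_
      rw [← map_zero (linealitySpace P).mkQ, mk_eq_mk_iff] at h
      simpa using h.1
    exists_le_smul_unit := fun x => by
      obtain ⟨v, rfl⟩ := (linealitySpace P).mkQ_surjective x
      obtain ⟨r, hr⟩ := hunit v
      exact ⟨r, r • e - v, hr, by rw [map_sub, map_smul]⟩
    le_zero_of_forall_le := fun x hx => by
      obtain ⟨v, rfl⟩ := (linealitySpace P).mkQ_surjective x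
      refine ⟨-v, harch v fun r hr => ?_, by simp⟩
      have := hx r hr
      rw [← map_smul] at this
      exact cone_le_iff.1 this }

variable (P : PointedCone ℝ V) (e : V) (he : e ∈ P) (hne : -e ∉ P)
    (hunit : ∀ v, ∃ r : ℝ, r • e - v ∈ P)
    (harch : ∀ v, (∀ r : ℝ, 0 < r → r • e - v ∈ P) → -v ∈ P)

/-- The projection of a vector space to the order-unit space defined by a cone. -/
def ofConeMk : V →ₗ[ℝ] ofCone P e he hne hunit harch := (linealitySpace P).mkQ

theorem ofConeMk_surjective : Function.Surjective (ofConeMk P e he hne hunit harch) :=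
  (linealitySpace P).mkQ_surjective

theorem ofConeMk_nonneg_iff {v : V} : 0 ≤ ofConeMk P e he hne hunit harch v ↔ v ∈ P := by
  have := cone_le_iff (P := P) (v := 0) (w := v)
  rw [map_zero, sub_zero] at this
  exact this

end OfCone

end OrderUnitSpace

/-! ### The limit of a sequence of spaces along correspondences -/

namespace CompactQuantumMetricSpace

open OrderUnitSpace

/-- Any element of an open Lip-ball extends to a thread: forwards by recursive choice of partners,
backwards one step at a time. The induction shifts the sequence of spaces, so that sequence has to
be universally quantified. -/
theorem exists_thread (n : ℕ) : ∀ (X : ℕ → CompactQuantumMetricSpace.{u})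
    (U : ∀ n, Set ((X n).space × (X (n + 1)).space)) (r : ℕ → ℝ)
    (_ : ∀ n, IsCorr (X n).lip (X (n + 1)).lip (U n) (r n)) (b : (X n).space),
    (X n).lip b < 1 → ∃ a : ∀ n, (X n).space, (∀ k, (X k).lip (a k) < 1) ∧
      (∀ k, (a k, a (k + 1)) ∈ U k) ∧ a n = b := by
  induction n with
  | zero =>
    intro X U r hU b hb
    choose f hf hf' using fun (k : ℕ) (p : {c : (X k).space // (X k).lip c < 1}) =>
      (hU k).exists_snd p.1 p.2
    let g : ∀ k, {c : (X k).space // (X k).lip c < 1} := fun k =>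
      Nat.rec ⟨b, hb⟩ (fun k p => ⟨f k p, hf' k p⟩) k
    exact ⟨fun k => (g k).1, fun k => (g k).2, fun k => hf k (g k), rfl⟩
  | succ n ih =>
    intro X U r hU b hb
    obtain ⟨a, ha1, ha2, rfl⟩ := ih (fun k => X (k + 1)) (fun k => U (k + 1)) (fun k => r (k + 1))
      (fun k => hU (k + 1)) b hb
    obtain ⟨a₀, h1, h2⟩ := (hU 0).exists_fst (a 0) (ha1 0)
    refine ⟨fun k => Nat.casesOn k a₀ a, fun k => ?_, fun k => ?_, rfl⟩
    · cases k with
      | zero => exact h2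
      | succ k => exact ha1 k
    · cases k with
      | zero => exact h1
      | succ k => exact ha2 k

section Limit

variable {X : ℕ → CompactQuantumMetricSpace.{u}} {U : ∀ n, Set ((X n).space × (X (n + 1)).space)}
  {T : ℕ → ℝ}

/-- The sequences whose consecutive terms are related by the correspondences `U n`. -/
def threads (U : ∀ n, Set ((X n).space × (X (n + 1)).space)) : Set (∀ n, (X n).space) :=
  {a | ∀ n, (a n, a (n + 1)) ∈ U n}

/-- The sequence of order units. -/
def unitSeq (X : ℕ → CompactQuantumMetricSpace.{u}) (n : ℕ) : (X n).space := (X n).space.unit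

/-- A sequence of correspondences between consecutive spaces, with distortions
`T n - T (n + 1)`. -/
abbrev IsCorrSeq (U : ∀ n, Set ((X n).space × (X (n + 1)).space)) (T : ℕ → ℝ) : Prop :=
  ∀ n, IsCorr (X n).lip (X (n + 1)).lip (U n) (T n - T (n + 1))

theorem convex_threads (hU : IsCorrSeq U T) : Convex ℝ (threads U) := fun _ ha _ hb _ _ hx hy hxy n =>
  (hU n).convex (ha n) (hb n) hx hy hxy

theorem balanced_threads (hU : IsCorrSeq U T) : Balanced ℝ (threads U) := by
  rintro c hc _ ⟨a, ha, rfl⟩ n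
  exact (hU n).balanced.smul_mem hc (ha n)

theorem add_unitSeq_mem_threads (hU : IsCorrSeq U T) {a : ∀ n, (X n).space} (ha : a ∈ threads U) (s : ℝ) :
    a + s • unitSeq X ∈ threads U := fun n => (hU n).add_unit _ _ (ha n) s

theorem neg_mem_threads (hU : IsCorrSeq U T) {a : ∀ n, (X n).space} (ha : a ∈ threads U) : -a ∈ threads U :=
  fun n => (hU n).neg_mem _ _ (ha n)

theorem zero_mem_threads (hU : IsCorrSeq U T) : 0 ∈ threads U := fun n => (hU n).zero_mem

theorem unitSeq_mem_threads (hU : IsCorrSeq U T) (s : ℝ) : s • unitSeq X ∈ threads U := by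
  simpa using add_unitSeq_mem_threads hU (zero_mem_threads hU) s

/-- The distortions `T k - T (k + 1)` telescope. When `T` tends to zero, `T n` is the total error
from level `n` on, a bound uniform in `m`. -/
theorem threads_nonneg_forward (hU : IsCorrSeq U T) {a : ∀ n, (X n).space} (ha : a ∈ threads U) {n m : ℕ} (hnm : n ≤ m)
    {s : ℝ} (h : 0 ≤ a n + s • (X n).space.unit) :
    0 ≤ a m + (s + (T n - T m)) • (X m).space.unit := by
  induction m, hnm using Nat.le_induction with
  | base => simpa using h
  | succ m _ ih =>
    refine nonneg_mono ((hU m).nonneg_snd_add (ha m) ih) ?_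
    linarith

theorem threads_nonneg_backward (hU : IsCorrSeq U T) {a : ∀ n, (X n).space} (ha : a ∈ threads U) {n m : ℕ}
    (hnm : n ≤ m) {s : ℝ} (h : 0 ≤ a m + s • (X m).space.unit) :
    0 ≤ a n + (s + (T n - T m)) • (X n).space.unit := by
  induction m, hnm using Nat.le_induction generalizing s with
  | base => simpa using h
  | succ m _ ih =>
    refine nonneg_mono (ih ((hU m).swap.nonneg_snd_add (ha m) h)) ?_
    linarith

theorem lip_threads_le (hU : IsCorrSeq U T) {a : ∀ n, (X n).space} (ha : a ∈ threads U) (n : ℕ) :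
    (X n).lip (a n) ≤ 1 := (hU n).lip_fst _ _ (ha n)

theorem tail_nonneg (hU : IsCorrSeq U T) (hT : Tendsto T atTop (𝓝 0)) (n : ℕ) : 0 ≤ T n :=
  (antitone_nat_of_succ_le fun n => sub_nonneg.1 (hU n).nonneg).le_of_tendsto hT n

theorem norm_threads_le (hU : IsCorrSeq U T) (hT : Tendsto T atTop (𝓝 0)) {a : ∀ n, (X n).space} (ha : a ∈ threads U)
    {n m : ℕ} (hnm : n ≤ m) : ‖a m‖ ≤ ‖a n‖ + T n := by
  obtain ⟨h1, h2⟩ := norm_le_iff.1 (le_refl ‖a n‖)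
  have h3 := tail_nonneg hU hT m
  exact norm_le_iff.2 ⟨nonneg_mono (threads_nonneg_forward hU ha hnm h1) (by linarith),
    nonneg_mono (threads_nonneg_forward hU (neg_mem_threads hU ha) hnm h2) (by linarith)⟩

/-- The cone of asymptotically nonnegative sequences. -/
def asymptoticCone (U : ∀ n, Set ((X n).space × (X (n + 1)).space)) :
    PointedCone ℝ (Submodule.span ℝ (threads U)) where
  carrier := {v | ∀ ε : ℝ, 0 < ε → ∀ᶠ n in atTop, 0 ≤ v.1 n + ε • (X n).space.unit}
  zero_mem' ε hε := Eventually.of_forall fun n => by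
    simpa using smul_nonneg hε.le (X n).space.unit_pos.le
  add_mem' := by
    intro v w hv hw ε hε
    filter_upwards [hv (ε / 2) (half_pos hε), hw (ε / 2) (half_pos hε)] with n h1 h2
    refine (add_nonneg h1 h2).trans_eq ?_
    change _ = v.1 n + w.1 n + _
    module
  smul_mem' := by
    rintro ⟨c, hc⟩ v hv ε hε
    have hc0 : 0 < c + 1 := by linarith
    filter_upwards [hv (ε / (c + 1)) (by positivity)] with n h
    have h1 := smul_nonneg hc h
    rw [smul_add, smul_smul] at h1
    refine nonneg_mono h1 ?_
    rw [mul_div_assoc', div_le_iff₀ hc0]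
    nlinarith

variable (hU : IsCorrSeq U T)
  (hT : Tendsto T atTop (𝓝 0))

/-- A thread, as an element of the span of all threads. -/
def threadMk {a : ∀ n, (X n).space} (ha : a ∈ threads U) : Submodule.span ℝ (threads U) :=
  ⟨a, Submodule.subset_span ha⟩

theorem exists_threadMk (hU : IsCorrSeq U T) (v : Submodule.span ℝ (threads U)) :
    ∃ t : ℝ, 0 < t ∧ ∃ (a : ∀ n, (X n).space) (ha : a ∈ threads U), v = t • threadMk ha := by
  obtain ⟨t, ht, a, ha, h⟩ := Submodule.exists_pos_mem_smul_of_mem_span (convex_threads hU)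
    (balanced_threads hU) ⟨0, zero_mem_threads hU⟩ v.2
  exact ⟨t, ht, a, ha, Subtype.ext h.symm⟩

/-- The sequence of order units, as an element of the span of all threads. -/
def threadUnit : Submodule.span ℝ (threads U) :=
  ⟨unitSeq X, by simpa using Submodule.subset_span (R := ℝ) (unitSeq_mem_threads hU 1)⟩

/-- The limit of a sequence of order-unit spaces along correspondences. -/
def limitSpace : OrderUnitSpace.{u} :=
  ofCone (asymptoticCone U) (threadUnit hU)
    (fun ε hε => Eventually.of_forall fun n => add_nonneg (X n).space.unit_pos.le
      (smul_nonneg hε.le (X n).space.unit_pos.le))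
    (fun h => by
      -- Any `ε < 1` would do: `-e + ε e` is then a negative multiple of the unit.
      obtain ⟨n, hn⟩ := (h (1 / 2) (by norm_num)).exists
      change 0 ≤ -(X n).space.unit + (1 / 2 : ℝ) • (X n).space.unit at hn
      have h1 : 0 ≤ (-1 / 2 : ℝ) • (X n).space.unit := hn.trans_eq (by module)
      have := nonneg_of_smul_unit_nonneg h1
      norm_num at this)
    (fun v => by
      obtain ⟨t, ht, a, ha, rfl⟩ := exists_threadMk hU v
      refine ⟨t * (‖a 0‖ + T 0), fun ε hε => Eventually.of_forall fun n => ?_⟩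
      have h1 := (norm_le_iff.1 (norm_threads_le hU hT ha (Nat.zero_le n))).2
      have h2 := add_nonneg (smul_nonneg ht.le h1) (smul_nonneg hε.le (X n).space.unit_pos.le)
      refine h2.trans_eq ?_
      change _ = (t * (‖a 0‖ + T 0)) • (X n).space.unit - t • a n + ε • (X n).space.unit
      module)
    (fun v hv ε hε => by
      filter_upwards [hv (ε / 2) (half_pos hε) (ε / 2) (half_pos hε)] with n hn
      refine hn.trans_eq ?_
      change (ε / 2) • (X n).space.unit - v.1 n + (ε / 2) • (X n).space.unit =
        -v.1 n + ε • (X n).space.unit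
      module)

/-- The class of a sequence in the limit. -/
def limitMk : Submodule.span ℝ (threads U) →ₗ[ℝ] limitSpace hU hT :=
  ofConeMk (asymptoticCone U) (threadUnit hU) _ _ _ _

theorem limitMk_surjective : Function.Surjective (limitMk hU hT) :=
  ofConeMk_surjective _ _ _ _ _ _

theorem limitMk_unit : limitMk hU hT (threadUnit hU) = (limitSpace hU hT).unit := rfl

theorem limitMk_nonneg_iff {v : Submodule.span ℝ (threads U)} :
    0 ≤ limitMk hU hT v ↔
      ∀ ε : ℝ, 0 < ε → ∀ᶠ n in atTop, 0 ≤ v.1 n + ε • (X n).space.unit :=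
  ofConeMk_nonneg_iff _ _ _ _ _ _

theorem limitMk_add_unit_nonneg_iff {v : Submodule.span ℝ (threads U)} {s : ℝ} :
    0 ≤ limitMk hU hT v + s • (limitSpace hU hT).unit ↔
      ∀ ε : ℝ, 0 < ε → ∀ᶠ n in atTop, 0 ≤ v.1 n + (s + ε) • (X n).space.unit := by
  rw [← limitMk_unit, ← map_smul, ← map_add, limitMk_nonneg_iff]
  simp only [add_smul, ← add_assoc]
  rfl

theorem norm_limitMk_le {v : Submodule.span ℝ (threads U)} {s : ℝ}
    (h : ∀ᶠ n in atTop, ‖v.1 n‖ ≤ s) : ‖limitMk hU hT v‖ ≤ s := by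
  rw [norm_le_iff, ← map_neg, limitMk_add_unit_nonneg_iff, limitMk_add_unit_nonneg_iff]
  constructor
  · intro ε hε
    filter_upwards [h] with n hn
    exact nonneg_mono (norm_le_iff.1 hn).1 (by linarith)
  · intro ε hε
    filter_upwards [h] with n hn
    exact nonneg_mono (norm_le_iff.1 hn).2 (by linarith)

/-- Asymptotic positivity holds up to `ε` at some level `m ≥ n`; going back to level `n` costs at
most `T n`. -/
theorem threads_nonneg_of_limitMk {a : ∀ n, (X n).space} (ha : a ∈ threads U) {s : ℝ}
    (h : 0 ≤ limitMk hU hT (threadMk ha) + s • (limitSpace hU hT).unit) (n : ℕ) :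
    0 ≤ a n + (s + T n) • (X n).space.unit := by
  refine nonneg_of_forall_pos fun ε hε => ?_
  obtain ⟨m, hnm, hm⟩ := ((eventually_ge_atTop n).and
    ((limitMk_add_unit_nonneg_iff hU hT).1 h ε hε)).exists
  rw [add_assoc, ← add_smul]
  exact nonneg_mono (threads_nonneg_backward hU ha hnm hm) (by linarith [tail_nonneg hU hT m])

theorem limitMk_nonneg_of_threads {a : ∀ n, (X n).space} (ha : a ∈ threads U) {n : ℕ}
    (h : 0 ≤ a n) : 0 ≤ limitMk hU hT (threadMk ha) + T n • (limitSpace hU hT).unit := by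
  rw [limitMk_add_unit_nonneg_iff]
  intro ε hε
  filter_upwards [eventually_ge_atTop n] with m hm
  have := threads_nonneg_forward hU ha hm (s := 0) (by simpa using h)
  exact nonneg_mono this (by linarith [tail_nonneg hU hT m])

theorem norm_limitMk_threadMk_le {a : ∀ n, (X n).space} (ha : a ∈ threads U) (n : ℕ) :
    ‖limitMk hU hT (threadMk ha)‖ ≤ ‖a n‖ + T n := by
  refine norm_limitMk_le hU hT ?_
  filter_upwards [eventually_ge_atTop n] with m hm
  exact norm_threads_le hU hT ha hm

theorem norm_threads_le_norm_limitMk {a : ∀ n, (X n).space} (ha : a ∈ threads U) (n : ℕ) :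
    ‖a n‖ ≤ ‖limitMk hU hT (threadMk ha)‖ + T n := by
  obtain ⟨h1, h2⟩ := norm_le_iff.1 (le_refl ‖limitMk hU hT (threadMk ha)‖)
  have h3 := threads_nonneg_of_limitMk hU hT (neg_mem_threads hU ha) h2 n
  exact norm_le_iff.2 ⟨threads_nonneg_of_limitMk hU hT ha h1 n, h3⟩

/-- The Lip-ball of the limit: the classes of threads. -/
def limitBall : Set (limitSpace hU hT) := limitMk hU hT '' {v | v.1 ∈ threads U}

theorem convex_limitBall : Convex ℝ (limitBall hU hT) :=
  ((convex_threads hU).linear_preimage (Submodule.span ℝ (threads U)).subtype).linear_image _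

theorem balanced_limitBall : Balanced ℝ (limitBall hU hT) := by
  rintro c hc _ ⟨_, ⟨v, hv, rfl⟩, rfl⟩
  exact ⟨c • v, (balanced_threads hU).smul_mem hc hv, map_smul _ _ _⟩

theorem limitMk_threadMk_mem {a : ∀ n, (X n).space} (ha : a ∈ threads U) :
    limitMk hU hT (threadMk ha) ∈ limitBall hU hT := ⟨threadMk ha, ha, rfl⟩

theorem absorbent_limitBall : Absorbent ℝ (limitBall hU hT) := by
  refine (balanced_limitBall hU hT).absorbent fun x => ?_
  obtain ⟨v, rfl⟩ := limitMk_surjective hU hT x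
  obtain ⟨t, ht, a, ha, rfl⟩ := exists_threadMk hU v
  refine ⟨t⁻¹, inv_pos.2 ht, ?_⟩
  rw [map_smul, smul_smul, inv_mul_cancel₀ ht.ne', one_smul]
  exact limitMk_threadMk_mem hU hT ha

/-- The Lip-norm of the limit. -/
noncomputable def limitLip : Seminorm ℝ (limitSpace hU hT) :=
  gaugeSeminorm (balanced_limitBall hU hT) (convex_limitBall hU hT) (absorbent_limitBall hU hT)

theorem limitLip_threadMk_le {a : ∀ n, (X n).space} (ha : a ∈ threads U) :
    limitLip hU hT (limitMk hU hT (threadMk ha)) ≤ 1 :=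
  gauge_le_one_of_mem (limitMk_threadMk_mem hU hT ha)

theorem exists_of_limitLip_lt {x : limitSpace hU hT} {t : ℝ} (h : limitLip hU hT x < t) :
    ∃ s : ℝ, 0 < s ∧ s < t ∧ ∃ (a : ∀ n, (X n).space) (ha : a ∈ threads U),
      x = s • limitMk hU hT (threadMk ha) := by
  obtain ⟨s, hs, hst, _, ⟨v, hv, rfl⟩, rfl⟩ :=
    exists_lt_of_gauge_lt (absorbent_limitBall hU hT) h
  exact ⟨s, hs, hst, v.1, hv, rfl⟩

/-- The gauge bound `1` need not be attained by a thread. Any factor above `1` would serve, since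
the result is used only for boundedness and total boundedness. -/
theorem exists_thread_of_limitLip_le {x : limitSpace hU hT} (h : limitLip hU hT x ≤ 1) :
    ∃ (a : ∀ n, (X n).space) (ha : a ∈ threads U), x = (2 : ℝ) • limitMk hU hT (threadMk ha) := by
  obtain ⟨s, hs, hst, a, ha, rfl⟩ := exists_of_limitLip_lt hU hT (h.trans_lt one_lt_two)
  have ha' : (s / 2) • a ∈ threads U := (balanced_threads hU).smul_mem (by
    rw [Real.norm_of_nonneg (by positivity)]; linarith) ha
  refine ⟨_, ha', ?_⟩
  have e : threadMk ha' = (s / 2) • threadMk ha := rfl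
  rw [e, map_smul, smul_smul]
  congr 1
  ring

theorem exists_norm_limitMk_sub_le : ∃ R : ℝ, 0 ≤ R ∧ ∀ (a : ∀ n, (X n).space)
    (ha : a ∈ threads U), ∃ s : ℝ,
      ‖limitMk hU hT (threadMk ha) - s • (limitSpace hU hT).unit‖ ≤ R := by
  obtain ⟨R, hR0, hR⟩ := (X 0).isLipNorm.exists_norm_sub_le
  have hT0 := tail_nonneg hU hT 0
  refine ⟨R + T 0, by positivity, fun a ha => ?_⟩
  obtain ⟨s, hs⟩ := hR (a 0) (lip_threads_le hU ha 0)
  refine ⟨s, ?_⟩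
  have ha' := add_unitSeq_mem_threads hU ha (-s)
  have h1 := norm_limitMk_threadMk_le hU hT ha' 0
  have e : threadMk ha' = threadMk ha + (-s) • threadUnit hU := rfl
  rw [e, map_add, map_smul, limitMk_unit, neg_smul, ← sub_eq_add_neg] at h1
  refine h1.trans (add_le_add_left ?_ _)
  change ‖a 0 + (-s) • (X 0).space.unit‖ ≤ R
  rwa [neg_smul, ← sub_eq_add_neg]

/-- Rieffel's criterion again: a thread is determined in norm, up to an error governed by `T n`, by
its `n`-th term, so boundedness is inherited from `X 0` and total boundedness from `X n` with `n`
large. -/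
theorem isLipNorm_limitLip : IsLipNorm (limitLip hU hT) := by
  obtain ⟨R, hR0, hR⟩ := exists_norm_limitMk_sub_le hU hT
  refine IsLipNorm.of_totallyBounded (R := 2 * R) (fun x => ⟨fun hx => ?_, ?_⟩) (fun x hx => ?_)
    fun M => ?_
  · have hmem : x ∈ closure (Submodule.span ℝ {(limitSpace hU hT).unit} :
        Set (limitSpace hU hT)) := by
      rw [Metric.mem_closure_iff]
      intro ε hε
      have hpos : 0 < ε / (R + 1) := by positivity
      obtain ⟨s, hs, hst, a, ha, rfl⟩ := exists_of_limitLip_lt hU hT (hx.trans_lt hpos)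
      obtain ⟨c, hc⟩ := hR a ha
      refine ⟨(s * c) • (limitSpace hU hT).unit,
        Submodule.smul_mem _ _ (Submodule.mem_span_singleton_self _), ?_⟩
      rw [dist_eq_norm, mul_smul, ← smul_sub, norm_smul, Real.norm_of_nonneg hs.le]
      rw [lt_div_iff₀ (by positivity)] at hst
      nlinarith
    rw [(Submodule.closed_of_finiteDimensional _).closure_eq] at hmem
    obtain ⟨r, hr⟩ := Submodule.mem_span_singleton.1 hmem
    exact ⟨r, hr.symm⟩
  · rintro ⟨s, rfl⟩
    refine le_antisymm (le_of_forall_pos_le_add fun ε hε => ?_) (apply_nonneg _ _)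
    have h1 := limitLip_threadMk_le hU hT (unitSeq_mem_threads hU (ε⁻¹ * s))
    have e : threadMk (unitSeq_mem_threads hU (ε⁻¹ * s)) = ε⁻¹ • s • threadUnit hU :=
      Subtype.ext (mul_smul _ _ _)
    rw [e, map_smul (limitMk hU hT), map_smul (limitMk hU hT), limitMk_unit, map_smul_eq_mul,
      Real.norm_of_nonneg (inv_nonneg.2 hε.le), inv_mul_le_one₀ hε] at h1
    simpa using h1
  · obtain ⟨a, ha, rfl⟩ := exists_thread_of_limitLip_le hU hT hx
    obtain ⟨s, hs⟩ := hR a ha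
    refine ⟨2 * s, ?_⟩
    rw [mul_smul, ← smul_sub, norm_smul, Real.norm_of_nonneg zero_le_two]
    linarith
  · rw [totallyBounded_iff_exists_coloring]
    intro ε hε
    -- Half the difference of two threads is a thread, and the points are twice the classes of their
    -- threads. Hence their distance is at most four times `ε / 8`, from terms within `ε / 4` of
    -- each other, plus `T n < ε / 8`.
    obtain ⟨n, hn⟩ := (hT.eventually (gt_mem_nhds (show (0 : ℝ) < ε / 8 by positivity))).exists
    obtain ⟨ι, c, hc, hcs⟩ := totallyBounded_iff_exists_coloring.1
      ((X n).isLipNorm.totallyBounded (M / 2 + T n)) (ε / 4) (by positivity)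
    have hex : ∀ x : limitSpace hU hT, ∃ (a : ∀ n, (X n).space), limitLip hU hT x ≤ 1 →
        ∃ ha : a ∈ threads U, x = (2 : ℝ) • limitMk hU hT (threadMk ha) := fun x => by
      by_cases hx : limitLip hU hT x ≤ 1
      · obtain ⟨a, ha, h⟩ := exists_thread_of_limitLip_le hU hT hx
        exact ⟨a, fun _ => ⟨ha, h⟩⟩
      · exact ⟨0, fun h => (hx h).elim⟩
    choose f hf using hex
    have hmem : ∀ x : limitSpace hU hT, limitLip hU hT x ≤ 1 ∧ ‖x‖ ≤ M →
        f x n ∈ {a | (X n).lip a ≤ 1 ∧ ‖a‖ ≤ M / 2 + T n} := fun x hx => by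
      obtain ⟨ha, hxa⟩ := hf x hx.1
      refine ⟨lip_threads_le hU ha n, (norm_threads_le_norm_limitMk hU hT ha n).trans ?_⟩
      have h1 := hx.2
      rw [hxa, norm_smul, Real.norm_of_nonneg zero_le_two] at h1
      linarith
    refine ⟨ι, fun x => c (f x n), hc.subset ?_, fun x hx y hy hxy => ?_⟩
    · rintro _ ⟨x, hx, rfl⟩
      exact ⟨_, hmem x hx, rfl⟩
    · have h1 := hcs _ (hmem x hx) _ (hmem y hy) hxy
      obtain ⟨ha, hxa⟩ := hf x hx.1
      obtain ⟨hb, hyb⟩ := hf y hy.1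
      have hd : (1 / 2 : ℝ) • (f x - f y) ∈ threads U := fun k => (hU k).half_sub_mem (ha k) (hb k)
      have h2 := norm_limitMk_threadMk_le hU hT hd n
      have e : threadMk hd = (1 / 2 : ℝ) • (threadMk ha - threadMk hb) := rfl
      have e1 : ((1 / 2 : ℝ) • (f x - f y)) n = (1 / 2 : ℝ) • (f x n - f y n) := rfl
      rw [e, e1, map_smul, map_sub, norm_smul, norm_smul,
        Real.norm_of_nonneg (show (0 : ℝ) ≤ 1 / 2 by norm_num), ← dist_eq_norm (f x n)] at h2
      rw [dist_eq_norm]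
      nth_rewrite 1 [hxa, hyb]
      rw [← smul_sub, norm_smul, Real.norm_of_nonneg zero_le_two]
      linarith

/-- The limit of a sequence of compact quantum metric spaces along correspondences. -/
noncomputable def limit : CompactQuantumMetricSpace.{u} :=
  ⟨limitSpace hU hT, limitLip hU hT, isLipNorm_limitLip hU hT⟩

/-- Every element of the open Lip-ball of `X n` lies on a thread, and passing between the `n`-th
term and the class of a thread changes the order by at most `T n`. -/
theorem isCorr_limit (n : ℕ) : IsCorr (X n).lip (limit hU hT).lip
    {p | ∃ (a : ∀ n, (X n).space) (ha : a ∈ threads U),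
      p = (a n, limitMk hU hT (threadMk ha))} (T n) where
  convex := by
    rintro _ ⟨a, ha, rfl⟩ _ ⟨b, hb, rfl⟩ x y hx hy hxy
    exact ⟨x • a + y • b, convex_threads hU ha hb hx hy hxy, rfl⟩
  neg_mem := by
    rintro _ _ ⟨a, ha, h⟩
    obtain ⟨rfl, rfl⟩ := Prod.ext_iff.1 h
    exact ⟨-a, neg_mem_threads hU ha, rfl⟩
  add_unit := by
    rintro _ _ ⟨a, ha, h⟩ s
    obtain ⟨rfl, rfl⟩ := Prod.ext_iff.1 h
    exact ⟨a + s • unitSeq X, add_unitSeq_mem_threads hU ha s, rfl⟩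
  lip_fst := by
    rintro _ _ ⟨a, ha, h⟩
    obtain ⟨rfl, rfl⟩ := Prod.ext_iff.1 h
    exact lip_threads_le hU ha n
  lip_snd := by
    rintro _ _ ⟨a, ha, h⟩
    obtain ⟨rfl, rfl⟩ := Prod.ext_iff.1 h
    exact limitLip_threadMk_le hU hT ha
  exists_snd b hb := by
    -- The class of a thread has Lip-norm at most `1` only; dividing by `s` first and multiplying
    -- back afterwards makes the bound strict.
    obtain ⟨s, hbs, hs1⟩ := exists_between hb
    have hs : 0 < s := (apply_nonneg _ _).trans_lt hbs
    obtain ⟨a, -, ha, hab⟩ := exists_thread n X U _ hU (s⁻¹ • b) (by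
      rw [map_smul_eq_mul, Real.norm_of_nonneg (inv_nonneg.2 hs.le), inv_mul_lt_one₀ hs]
      exact hbs)
    have hsa : s • a ∈ threads U := (balanced_threads hU).smul_mem (by
      rw [Real.norm_of_nonneg hs.le]; exact hs1.le) ha
    refine ⟨_, ⟨s • a, hsa, Prod.ext ?_ rfl⟩, ?_⟩
    · change b = s • a n
      rw [hab, smul_smul, mul_inv_cancel₀ hs.ne', one_smul]
    · change limitLip hU hT (s • limitMk hU hT (threadMk ha)) < 1
      rw [map_smul_eq_mul, Real.norm_of_nonneg hs.le]
      exact (mul_le_of_le_one_right hs.le (limitLip_threadMk_le hU hT ha)).trans_lt hs1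
  exists_fst x hx := by
    obtain ⟨s, hs, hs1, a, ha, rfl⟩ := exists_of_limitLip_lt hU hT hx
    have hsa : s • a ∈ threads U := (balanced_threads hU).smul_mem (by
      rw [Real.norm_of_nonneg hs.le]; exact hs1.le) ha
    refine ⟨_, ⟨s • a, hsa, rfl⟩, ?_⟩
    change (X n).lip (s • a n) < 1
    rw [map_smul_eq_mul, Real.norm_of_nonneg hs.le]
    exact (mul_le_of_le_one_right hs.le (lip_threads_le hU ha n)).trans_lt hs1
  nonneg_snd := by
    rintro _ _ ⟨a, ha, h⟩ h0
    obtain ⟨rfl, rfl⟩ := Prod.ext_iff.1 h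
    exact limitMk_nonneg_of_threads hU hT ha h0
  nonneg_fst := by
    rintro _ _ ⟨a, ha, h⟩ h0
    obtain ⟨rfl, rfl⟩ := Prod.ext_iff.1 h
    have := threads_nonneg_of_limitMk hU hT ha (s := 0)
      (h0.trans_eq (by rw [zero_smul, add_zero])) n
    rwa [zero_add] at this

end Limit

/-! ### The complete metric on isometry classes -/

theorem qDist_le_of_isometry {A A' B B' : CompactQuantumMetricSpace.{u}}
    (φ : Isometry A A') (ψ : Isometry B B') : A.qDist B ≤ A'.qDist B' := by
  refine (qDist_triangle A A' B).trans ?_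
  rw [φ.qDist_eq_zero, zero_add]
  refine (qDist_triangle A' B' B).trans ?_
  rw [qDist_comm B' B, ψ.qDist_eq_zero, add_zero]

/-- The quantum Gromov-Hausdorff distance of isometry classes. -/
noncomputable def classDist : IsometryClass.{u} → IsometryClass.{u} → ℝ≥0∞ :=
  Quotient.lift₂ qDist fun _ _ _ _ ⟨φ⟩ ⟨ψ⟩ =>
    le_antisymm (qDist_le_of_isometry φ ψ) (qDist_le_of_isometry φ.symm ψ.symm)

theorem isometryClass_surjective (x : IsometryClass.{u}) : ∃ A, isometryClass A = x :=
  Quotient.exists_rep x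

/-- The quantum Gromov-Hausdorff distance as an extended metric on isometry classes. -/
noncomputable abbrev isometryClassEMetricSpace : EMetricSpace IsometryClass.{u} where
  edist := classDist
  edist_self x := by
    obtain ⟨A, rfl⟩ := isometryClass_surjective x
    exact (Isometry.mk (LinearEquiv.refl ℝ _) (fun _ => Iff.rfl) rfl fun _ => rfl).qDist_eq_zero
  edist_comm x y := by
    obtain ⟨A, rfl⟩ := isometryClass_surjective x
    obtain ⟨B, rfl⟩ := isometryClass_surjective y
    exact qDist_comm A B
  edist_triangle x y z := by
    obtain ⟨A, rfl⟩ := isometryClass_surjective x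
    obtain ⟨B, rfl⟩ := isometryClass_surjective y
    obtain ⟨C, rfl⟩ := isometryClass_surjective z
    exact qDist_triangle A B C
  eq_of_edist_eq_zero {x y} h := by
    obtain ⟨A, rfl⟩ := isometryClass_surjective x
    obtain ⟨B, rfl⟩ := isometryClass_surjective y
    exact Quotient.sound (nonempty_isometry_of_qDist_eq_zero h)

theorem exists_limit (X : ℕ → CompactQuantumMetricSpace.{u})
    (h : ∀ n, (X n).qDist (X (n + 1)) < ENNReal.ofReal ((1 / 2) ^ n)) :
    ∃ A : CompactQuantumMetricSpace.{u}, ∀ n,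
      (X n).qDist A ≤ ENNReal.ofReal (2 * (1 / 2) ^ n) := by
  choose U hU using fun n => exists_isCorr_of_qDist_lt (h n)
  -- The tail sums of the distortions `(1 / 2) ^ n`.
  have hT : Tendsto (fun n : ℕ => 2 * (1 / 2 : ℝ) ^ n) atTop (𝓝 0) := by
    simpa using (tendsto_pow_atTop_nhds_zero_of_lt_one (r := (1 / 2 : ℝ)) (by norm_num)
      (by norm_num)).const_mul 2
  have hU' : IsCorrSeq U fun n => 2 * (1 / 2 : ℝ) ^ n := fun n => by
    have e : 2 * (1 / 2 : ℝ) ^ n - 2 * (1 / 2) ^ (n + 1) = (1 / 2) ^ n := by ring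
    simp only [e]
    exact hU n
  exact ⟨limit hU' hT, fun n => qDist_le_of_isCorr (isCorr_limit hU' hT n)⟩

theorem completeSpace_isometryClass :
    @CompleteSpace IsometryClass.{u} isometryClassEMetricSpace.toUniformSpace := by
  let _ := isometryClassEMetricSpace.{u}
  -- Completeness needs only sequences with a prescribed rate of convergence, so consecutive terms
  -- may be taken at distance less than `(1 / 2) ^ n`.
  refine EMetric.complete_of_convergent_controlled_sequences
    (fun n => ENNReal.ofReal ((1 / 2) ^ n)) (fun n => ENNReal.ofReal_pos.2 (by positivity)) ?_
  intro x hx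
  choose X hX using fun n => isometryClass_surjective (x n)
  obtain ⟨A, hA⟩ := exists_limit X fun n => by
    have := hx n n (n + 1) le_rfl n.le_succ
    rwa [← hX, ← hX] at this
  refine ⟨A.isometryClass, tendsto_iff_edist_tendsto_0.2 ?_⟩
  have hT : Tendsto (fun n : ℕ => ENNReal.ofReal (2 * (1 / 2 : ℝ) ^ n)) atTop (𝓝 0) := by
    have := (tendsto_pow_atTop_nhds_zero_of_lt_one (r := (1 / 2 : ℝ)) (by norm_num)
      (by norm_num)).const_mul 2
    simpa using ENNReal.tendsto_ofReal this
  refine tendsto_of_tendsto_of_tendsto_of_le_of_le tendsto_const_nhds hT (fun _ => zero_le)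
    fun n => ?_
  change edist (x n) A.isometryClass ≤ _
  rw [← hX]
  exact hA n

end CompactQuantumMetricSpace

end

theorem theorem12p11 :
    ∃ _ : MetricSpace CompactQuantumMetricSpace.IsometryClass.{u},
      (∀ A B : CompactQuantumMetricSpace.{u},
        edist A.isometryClass B.isometryClass = A.qDist B) ∧
      CompleteSpace CompactQuantumMetricSpace.IsometryClass.{u} := by
  let _ := CompactQuantumMetricSpace.isometryClassEMetricSpace.{u}
  refine ⟨EMetricSpace.toMetricSpace fun x y => ?_, fun A B => rfl,
    CompactQuantumMetricSpace.completeSpace_isometryClass⟩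
  obtain ⟨A, rfl⟩ := CompactQuantumMetricSpace.isometryClass_surjective x
  obtain ⟨B, rfl⟩ := CompactQuantumMetricSpace.isometryClass_surjective y
  exact (CompactQuantumMetricSpace.qDist_lt_top A B).ne
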